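/- Let $(R,\mathfrak m)$ be a $2$-dimensional Cohen–Macaulay (Noetherian) local ring with infinite residue field. Let $I$ be an $\mathfrak m$-primary ideal, let $K$ be an ideal of $R$ containing $I$ (possibly $K=R$), and let $J$ be a minimal reduction of $I$, i.e. an ideal which is minimal with respect to inclusion among the ideals $J'\subseteq I$ such that $I^{n+1}=J'I^n$ for some $n\ge 0$. Assume that $KI\cap J=KJ$. Write $\lambda$ for the length of $R$-modules, and put $$r_J^K(I)=\min\{\,n\ge 0 \mid KI^{n+1}=KJI^n\,\}.$$ Then there are unique integers $g_0,g_1,g_2$ such that $$\lambda(R/KI^n)=g_0\binom{n+1}{2}-g_1\,n+g_2\qquad\text{for all sufficiently large } n,$$ and $$r_J^K(I)\le g_1-\lambda(KI/KJ)+1+\lambda(R/K).$$ -/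

import Mathlib

namespace FiberCone

open IsLocalRing

variable {R : Type*} [CommRing R]

/-- A Noetherian local ring is Cohen–Macaulay if its maximal ideal contains a regular sequence
whose length is the Krull dimension of the ring. -/
def IsCohenMacaulayLocal (R : Type*) [CommRing R] [IsLocalRing R] : Prop :=
  IsNoetherianRing R ∧ ∃ rs : List R, (∀ x ∈ rs, x ∈ maximalIdeal R) ∧
    RingTheory.Sequence.IsRegular R rs ∧ (rs.length : WithBot ℕ∞) = ringKrullDim R

/-- `I` is `𝔪`-primary: it is primary with radical `𝔪`. -/
def IsMaximalPrimary [IsLocalRing R] (I : Ideal R) : Prop :=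
  I.IsPrimary ∧ I.radical = maximalIdeal R

/-- `J` is a reduction of `I`: `J ⊆ I` and `I ^ (n + 1) = J I ^ n` for some `n`. -/
def IsReduction (J I : Ideal R) : Prop :=
  J ≤ I ∧ ∃ n : ℕ, I ^ (n + 1) = J * I ^ n

/-- `J` is a minimal reduction of `I`: a reduction of `I` that is minimal with respect to
inclusion among all reductions of `I`. -/
def IsMinimalReduction (J I : Ideal R) : Prop :=
  Minimal (fun J' : Ideal R => IsReduction J' I) J

/-- The `K`-reduction number of `I` with respect to `J`: the least `n` with
`K I ^ (n + 1) = K J I ^ n`. (Such an `n` exists as soon as `J` is a reduction of `I`,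
see `IsReduction.kReductionNumber_spec`.) -/
noncomputable def kReductionNumber (K J I : Ideal R) : ℕ :=
  sInf {n : ℕ | K * I ^ (n + 1) = K * J * I ^ n}

theorem IsReduction.kReductionNumber_spec {J I : Ideal R} (h : IsReduction J I) (K : Ideal R) :
    IsLeast {n : ℕ | K * I ^ (n + 1) = K * J * I ^ n} (kReductionNumber K J I) := by
  obtain ⟨-, n, hn⟩ := h
  have hne : {n : ℕ | K * I ^ (n + 1) = K * J * I ^ n}.Nonempty :=
    ⟨n, show K * I ^ (n + 1) = K * J * I ^ n by rw [hn, mul_assoc]⟩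
  exact ⟨Nat.sInf_mem hne, fun m hm => Nat.sInf_le hm⟩

/-- The length `λ(Q / P)` of the `R`-module `Q / P`, for ideals `P ⊆ Q`. It is used only where this
length is finite, see `length_ne_top`. -/
noncomputable def quotLength (Q P : Ideal R) : ℕ :=
  (Module.length R (Q ⧸ P.submoduleOf Q)).toNat

/-- The length `λ(R / Q)` of the `R`-module `R / Q`. It is used only where this length is finite,
see `length_ringQuot_ne_top`. -/
noncomputable def ringQuotLength (Q : Ideal R) : ℕ :=
  (Module.length R (R ⧸ Q)).toNat

/-- `g 0, …, g d` are the coefficients of the Hilbert polynomial of `λ(R / K I ^ n)`, that is,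
`λ(R / K I ^ n) = ∑ i ≤ d, (-1) ^ i * g i * ((n + d - 1 - i).choose (d - i))` for all large `n`. -/
def IsHilbertCoeffs (d : ℕ) (K I : Ideal R) (g : Fin (d + 1) → ℤ) : Prop :=
  ∀ᶠ n : ℕ in Filter.atTop, (ringQuotLength (K * I ^ n) : ℤ) =
    ∑ i : Fin (d + 1), (-1) ^ (i : ℕ) * g i * ((n + d - 1 - i).choose (d - i) : ℤ)

theorem length_ringQuot_ne_top [IsLocalRing R] [IsNoetherianRing R] {Q : Ideal R} {n : ℕ}
    (h : maximalIdeal R ^ n ≤ Q) : Module.length R (R ⧸ Q) ≠ ⊤ := by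
  have : Ring.KrullDimLE 0 (R ⧸ Q) := by
    rw [Ideal.krullDimLE_zero_quotient_iff_forall_minimalPrimes_isMaximal]
    intro p hp
    have hpp : p.IsPrime := hp.1.1
    have hle : maximalIdeal R ≤ p := hpp.le_of_pow_le (h.trans hp.1.2)
    rw [← (maximalIdeal.isMaximal R).eq_of_le hpp.ne_top hle]
    exact maximalIdeal.isMaximal R
  have : IsArtinianRing (R ⧸ Q) := IsNoetherianRing.isArtinianRing_of_krullDimLE_zero
  have : IsArtinian R (R ⧸ Q) :=
    isArtinian_of_surjective_algebraMap (S := R) (R := R ⧸ Q) Ideal.Quotient.mk_surjective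
  exact Module.length_ne_top

theorem length_ne_top [IsLocalRing R] [IsNoetherianRing R] {P : Ideal R} {n : ℕ}
    (h : maximalIdeal R ^ n ≤ P) (Q : Ideal R) :
    Module.length R (Q ⧸ P.submoduleOf Q) ≠ ⊤ := by
  have hker : LinearMap.ker (P.mkQ ∘ₗ Submodule.subtype Q) = P.submoduleOf Q := by
    rw [LinearMap.ker_comp, Submodule.ker_mkQ, Submodule.submoduleOf]
  have hinj : Function.Injective
      ((P.submoduleOf Q).liftQ (P.mkQ ∘ₗ Submodule.subtype Q) hker.ge) := by
    rw [← LinearMap.ker_eq_bot]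
    exact Submodule.ker_liftQ_eq_bot _ _ _ hker.le
  exact ne_top_of_le_ne_top (length_ringQuot_ne_top h) (Module.length_le_of_injective _ hinj)

end FiberCone

namespace FiberCone

open IsLocalRing

/-! ### Colengths of ideals containing a power of the maximal ideal. -/

section Length

variable {R : Type*} [CommRing R]

/-! Write J = (x, y) with x, y a regular pair. This is possible because a minimal reduction has only
two generators here (`IsMinimalReduction.exists_span_pair`). Let L_n be the Ratliff–Rush closure of
the filtration K I^n: it agrees with K I^n for large n and satisfies (L_{n+1} : J) = L_n.

The Koszul complex of x, y gives λ(R/JM) + λ(R/(M : J)) = λ(R/J) + 2 λ(R/M) for each M of finite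
colength. For M = L_{n+1} the colon is L_n, so v_n = λ(L_{n+1}/J L_n) differs from λ(R/J) by a
second difference of λ(R/L_n). As v_n = 0 for large n, λ(R/K I^n) is eventually quadratic with
leading coefficient λ(R/J); summing all v_n telescopes to λ(R/L_0) + g_1 (`eventually_sum_jump_eq`).

Now view the sum of the L_n as a module over the Rees algebra of J, modulo the submodule generated
by K in degree 0 and K I in degree 1. It needs at most ν = λ(L_0/K) + λ(L_1/(J L_0 + K I)) + v_1 +
v_2 + ... generators. From K I ∩ J = K J one gets J L_0 ∩ K I = K J, so the middle term is v_0 -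
λ(KI/KJ) and ν = λ(R/K) + g_1 - λ(KI/KJ).

A determinant trick on these generators (`pow_card_mul_le`), with t ≤ ν of them, gives K I^{t+2} = K
J I^{t+1}, so the reduction number is at most ν + 1. -/

theorem length_quotient_eq_add {P Q : Ideal R} (h : P ≤ Q) :
    Module.length R (R ⧸ P) =
      Module.length R (Q ⧸ P.submoduleOf Q) + Module.length R (R ⧸ Q) := by
  have hker : LinearMap.ker (P.mkQ ∘ₗ Submodule.subtype Q) = P.submoduleOf Q := by
    rw [LinearMap.ker_comp, Submodule.ker_mkQ, Submodule.submoduleOf]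
  refine Module.length_eq_add_of_exact
    ((P.submoduleOf Q).liftQ (P.mkQ ∘ₗ Submodule.subtype Q) hker.ge)
    (Submodule.factor h) ?_ (Submodule.factor_surjective h) ?_
  · rw [← LinearMap.ker_eq_bot]
    exact Submodule.ker_liftQ_eq_bot _ _ _ hker.le
  · rw [LinearMap.exact_iff, Submodule.range_liftQ, LinearMap.range_comp, Submodule.range_subtype]
    ext z
    obtain ⟨z, rfl⟩ := Submodule.mkQ_surjective _ z
    have hz : Submodule.factor h (P.mkQ z) = Q.mkQ z := rfl
    rw [LinearMap.mem_ker, hz, Submodule.mkQ_apply, Submodule.Quotient.mk_eq_zero,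
      Submodule.mem_map]
    constructor
    · intro hz
      exact ⟨z, hz, rfl⟩
    · rintro ⟨w, hw, hwz⟩
      rw [Submodule.mkQ_apply, Submodule.mkQ_apply, Submodule.Quotient.eq] at hwz
      have := Q.sub_mem hw (h hwz)
      rwa [sub_sub_cancel] at this

variable [IsLocalRing R]

/-- `Q` contains a power of the maximal ideal. -/
def ContainsMaximalPow (Q : Ideal R) : Prop :=
  ∃ n : ℕ, maximalIdeal R ^ n ≤ Q

namespace ContainsMaximalPow

theorem mono {P Q : Ideal R} (hP : ContainsMaximalPow P) (h : P ≤ Q) : ContainsMaximalPow Q :=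
  ⟨hP.choose, hP.choose_spec.trans h⟩

theorem mul {P Q : Ideal R} (hP : ContainsMaximalPow P) (hQ : ContainsMaximalPow Q) :
    ContainsMaximalPow (P * Q) := by
  obtain ⟨m, hm⟩ := hP
  obtain ⟨n, hn⟩ := hQ
  exact ⟨m + n, by rw [pow_add]; exact Ideal.mul_mono hm hn⟩

theorem pow {P : Ideal R} (hP : ContainsMaximalPow P) (n : ℕ) : ContainsMaximalPow (P ^ n) := by
  obtain ⟨m, hm⟩ := hP
  exact ⟨m * n, by rw [pow_mul]; exact Ideal.pow_right_mono hm n⟩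

theorem inf {P Q : Ideal R} (hP : ContainsMaximalPow P) (hQ : ContainsMaximalPow Q) :
    ContainsMaximalPow (P ⊓ Q) :=
  (hP.mul hQ).mono Ideal.mul_le_inf

theorem length_ne_top [IsNoetherianRing R] {P : Ideal R} (hP : ContainsMaximalPow P) :
    Module.length R (R ⧸ P) ≠ ⊤ :=
  length_ringQuot_ne_top hP.choose_spec

theorem coe_ringQuotLength [IsNoetherianRing R] {P : Ideal R} (hP : ContainsMaximalPow P) :
    (ringQuotLength P : ℕ∞) = Module.length R (R ⧸ P) :=
  ENat.natCast_toNat hP.length_ne_top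

end ContainsMaximalPow

variable [IsNoetherianRing R]

theorem ringQuotLength_top {R : Type*} [CommRing R] : ringQuotLength (⊤ : Ideal R) = 0 := by
  have : Subsingleton (R ⧸ (⊤ : Ideal R)) := Ideal.Quotient.subsingleton_iff.2 rfl
  simp [ringQuotLength, Module.length_eq_zero]

theorem quotLength_add_ringQuotLength {P Q : Ideal R} (hP : ContainsMaximalPow P) (h : P ≤ Q) :
    quotLength Q P + ringQuotLength Q = ringQuotLength P := by
  rw [ringQuotLength, ringQuotLength, quotLength, length_quotient_eq_add h, ENat.toNat_add
    (FiberCone.length_ne_top hP.choose_spec Q) (hP.mono h).length_ne_top]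

theorem ringQuotLength_anti {P Q : Ideal R} (hP : ContainsMaximalPow P) (h : P ≤ Q) :
    ringQuotLength Q ≤ ringQuotLength P := by
  have := quotLength_add_ringQuotLength hP h
  lia

theorem ringQuotLength_strictAnti {P Q : Ideal R} (hP : ContainsMaximalPow P) (h : P < Q) :
    ringQuotLength Q < ringQuotLength P := by
  have h1 := quotLength_add_ringQuotLength hP h.le
  have h2 : quotLength Q P ≠ 0 := by
    intro h0
    rw [quotLength, ENat.toNat_eq_zero] at h0
    have h0 := h0.resolve_right (FiberCone.length_ne_top hP.choose_spec Q)
    rw [Module.length_eq_zero_iff, Submodule.Quotient.subsingleton_iff,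
      Submodule.submoduleOf_eq_top] at h0
    exact h.not_ge h0
  lia

theorem ringQuotLength_sup_add_inf {P Q : Ideal R} (hP : ContainsMaximalPow P)
    (hQ : ContainsMaximalPow Q) :
    ringQuotLength (P ⊔ Q) + ringQuotLength (P ⊓ Q) = ringQuotLength P + ringQuotLength Q := by
  have h1 := quotLength_add_ringQuotLength (hP.inf hQ) (inf_le_left : P ⊓ Q ≤ P)
  have h2 := quotLength_add_ringQuotLength hQ (le_sup_right : Q ≤ P ⊔ Q)
  have h3 : quotLength P (P ⊓ Q) = quotLength (P ⊔ Q) Q := by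
    rw [quotLength, quotLength]
    congr 1
    exact (LinearMap.quotientInfEquivSupQuotient P Q).length_eq
  lia

/-- Each adjoined element outside the current ideal lowers the colength by at least one, so λ(Q/P)
elements suffice. This converts lengths into numbers of generators. -/
theorem exists_finset_span_sup_eq {P : Ideal R} (hP : ContainsMaximalPow P) :
    ∀ Q : Ideal R, P ≤ Q →
      ∃ s : Finset R, P ⊔ Ideal.span (s : Set R) = Q ∧
        s.card + ringQuotLength Q ≤ ringQuotLength P := by
  classical
  suffices H : ∀ (k : ℕ) (P : Ideal R), ContainsMaximalPow P → ∀ Q : Ideal R, P ≤ Q →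
      ringQuotLength P ≤ k + ringQuotLength Q →
      ∃ s : Finset R, P ⊔ Ideal.span (s : Set R) = Q ∧
        s.card + ringQuotLength Q ≤ ringQuotLength P from
    fun Q hQ => H (ringQuotLength P) P hP Q hQ (by lia)
  intro k
  induction k with
  | zero =>
    intro P hP Q hPQ hk
    refine ⟨∅, ?_, by simpa using ringQuotLength_anti hP hPQ⟩
    rcases hPQ.eq_or_lt with h | h
    · simpa using h
    · have := ringQuotLength_strictAnti hP h
      lia
  | succ k ih =>
    intro P hP Q hPQ hk
    rcases hPQ.eq_or_lt with h | h
    · exact ⟨∅, by simpa using h, by simp [h]⟩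
    · obtain ⟨x, hxQ, hxP⟩ := SetLike.exists_of_lt h
      have hlt : P < P ⊔ Ideal.span {x} := by
        rw [left_lt_sup, Ideal.span_singleton_le_iff_mem]
        exact hxP
      have h1 := ringQuotLength_strictAnti hP hlt
      obtain ⟨s, hs, hc⟩ := ih (P ⊔ Ideal.span {x}) (hP.mono hlt.le) Q
        (sup_le hPQ ((Ideal.span_singleton_le_iff_mem _).2 hxQ)) (by lia)
      refine ⟨insert x s, ?_, ?_⟩
      · rw [Finset.coe_insert, Ideal.span_insert, ← sup_assoc, hs]
      · have := Finset.card_insert_le x s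
        lia

end Length

/-! ### The Koszul length formula for a regular pair. -/

section Koszul

variable {R : Type*} [CommRing R]

/-- A pair `x, y` such that `x` is regular and `y` is regular modulo `x`. -/
def IsRegularPair (x y : R) : Prop :=
  (∀ a, x * a = 0 → a = 0) ∧ ∀ a, x ∣ y * a → x ∣ a

theorem IsRegularPair.exists_of_mul_add_mul_eq_zero {x y : R} (h : IsRegularPair x y) {a b : R}
    (hab : a * x + b * y = 0) : ∃ c, a = c * y ∧ b = -(c * x) := by
  obtain ⟨c, rfl⟩ := h.2 b ⟨-a, by linear_combination hab⟩
  refine ⟨-c, ?_, by ring⟩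
  have := h.1 (a + c * y) (by linear_combination hab)
  linear_combination this

/-- Additivity of length on the exact sequence 0 → R/(M : J) → (R/M)² → J/JM → 0, with maps c ↦ (cy,
-cx) and (a, b) ↦ ax + by. -/
theorem length_span_pair_quotient {x y : R} (h : IsRegularPair x y) {J : Ideal R}
    (hJ : J = Ideal.span {x, y}) (M : Ideal R) :
    Module.length R (R ⧸ M) + Module.length R (R ⧸ M) =
      Module.length R (R ⧸ M.colon (J : Set R)) +
        Module.length R (J ⧸ (J * M).submoduleOf J) := by
  have hxJ : x ∈ J := hJ ▸ Ideal.subset_span (by simp)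
  have hyJ : y ∈ J := hJ ▸ Ideal.subset_span (by simp)
  have hcolon : ∀ r, r ∈ M.colon (J : Set R) ↔ r * x ∈ M ∧ r * y ∈ M := by
    intro r
    rw [hJ, Ideal.colon_span, Submodule.mem_colon]
    simp
  have hJM : ∀ r, r ∈ J * M ↔ ∃ a ∈ M, ∃ b ∈ M, r = a * x + b * y := by
    intro r
    rw [hJ, Ideal.span_insert, Ideal.sup_mul, Submodule.mem_sup]
    simp only [Ideal.mem_span_singleton_mul]
    constructor
    · rintro ⟨_, ⟨a, ha, rfl⟩, _, ⟨b, hb, rfl⟩, rfl⟩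
      exact ⟨a, ha, b, hb, by ring⟩
    · rintro ⟨a, ha, b, hb, rfl⟩
      exact ⟨_, ⟨a, ha, rfl⟩, _, ⟨b, hb, rfl⟩, by ring⟩
  let f₁ : R →ₗ[R] (R ⧸ M) × (R ⧸ M) :=
    (M.mkQ ∘ₗ LinearMap.mulRight R y).prod (-(M.mkQ ∘ₗ LinearMap.mulRight R x))
  have hf₁ : LinearMap.ker f₁ = M.colon (J : Set R) := by
    ext r
    rw [hcolon, and_comm, LinearMap.mem_ker, ← Submodule.Quotient.mk_eq_zero M,
      ← Submodule.Quotient.mk_eq_zero M, ← neg_eq_zero (a := Submodule.Quotient.mk (r * x))]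
    exact Prod.mk_eq_zero
  let f : (R ⧸ M.colon (J : Set R)) →ₗ[R] (R ⧸ M) × (R ⧸ M) :=
    Submodule.liftQ _ f₁ hf₁.ge
  have hf : Function.Injective f := by
    rw [← LinearMap.ker_eq_bot]
    exact Submodule.ker_liftQ_eq_bot _ _ _ hf₁.le
  have hfv : ∀ c : R, f ((M.colon (J : Set R)).mkQ c) = (M.mkQ (c * y), M.mkQ (-(c * x))) :=
    fun c => rfl
  let gx : R →ₗ[R] J ⧸ (J * M).submoduleOf J :=
    ((J * M).submoduleOf J).mkQ ∘ₗ LinearMap.toSpanSingleton R J ⟨x, hxJ⟩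
  let gy : R →ₗ[R] J ⧸ (J * M).submoduleOf J :=
    ((J * M).submoduleOf J).mkQ ∘ₗ LinearMap.toSpanSingleton R J ⟨y, hyJ⟩
  have hgx : M ≤ LinearMap.ker gx := by
    intro r hr
    simp only [gx, LinearMap.mem_ker, LinearMap.comp_apply, Submodule.mkQ_apply,
      Submodule.Quotient.mk_eq_zero, LinearMap.toSpanSingleton_apply]
    rw [Submodule.submoduleOf, Submodule.mem_comap, mul_comm J M]
    exact Ideal.mul_mem_mul hr hxJ
  have hgy : M ≤ LinearMap.ker gy := by
    intro r hr
    simp only [gy, LinearMap.mem_ker, LinearMap.comp_apply, Submodule.mkQ_apply,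
      Submodule.Quotient.mk_eq_zero, LinearMap.toSpanSingleton_apply]
    rw [Submodule.submoduleOf, Submodule.mem_comap, mul_comm J M]
    exact Ideal.mul_mem_mul hr hyJ
  let g : (R ⧸ M) × (R ⧸ M) →ₗ[R] J ⧸ (J * M).submoduleOf J :=
    (Submodule.liftQ M gx hgx).coprod (Submodule.liftQ M gy hgy)
  have hg : ∀ a b : R, g (M.mkQ a, M.mkQ b) = ((J * M).submoduleOf J).mkQ
      ⟨a * x + b * y, J.add_mem (J.mul_mem_left a hxJ) (J.mul_mem_left b hyJ)⟩ := by
    intro a b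
    simp only [g, LinearMap.coprod_apply, Submodule.mkQ_apply, Submodule.liftQ_apply, gx, gy,
      LinearMap.comp_apply, LinearMap.toSpanSingleton_apply, ← Submodule.Quotient.mk_add]
    rfl
  have hgs : Function.Surjective g := by
    intro z
    obtain ⟨⟨z, hz⟩, rfl⟩ := Submodule.mkQ_surjective _ z
    obtain ⟨a, b, rfl⟩ := Ideal.mem_span_pair.1 (hJ ▸ hz)
    exact ⟨_, hg a b⟩
  rw [← Module.length_prod]
  refine Module.length_eq_add_of_exact f g hf hgs ?_
  rintro ⟨a, b⟩
  obtain ⟨a, rfl⟩ := Submodule.mkQ_surjective _ a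
  obtain ⟨b, rfl⟩ := Submodule.mkQ_surjective _ b
  rw [hg, Submodule.mkQ_apply, Submodule.Quotient.mk_eq_zero, Submodule.submoduleOf,
    Submodule.mem_comap, Submodule.subtype_apply, hJM]
  constructor
  -- Correcting (a, b) by elements of M turns the relation modulo JM into a genuine syzygy of x, y,
  -- which is a multiple of the Koszul one.
  · rintro ⟨a', ha', b', hb', hab⟩
    obtain ⟨c, hca, hcb⟩ := h.exists_of_mul_add_mul_eq_zero
      (a := a - a') (b := b - b') (by linear_combination hab)
    refine ⟨(M.colon (J : Set R)).mkQ c, ?_⟩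
    rw [hfv, Prod.mk.injEq, Submodule.mkQ_apply, Submodule.mkQ_apply, Submodule.mkQ_apply,
      Submodule.mkQ_apply, Submodule.Quotient.eq, Submodule.Quotient.eq]
    refine ⟨?_, ?_⟩
    · rw [← hca]
      simpa using ha'
    · rw [← hcb]
      simpa using hb'
  · rintro ⟨c, hc⟩
    obtain ⟨c, rfl⟩ := Submodule.mkQ_surjective _ c
    rw [hfv, Prod.mk.injEq, Submodule.mkQ_apply, Submodule.mkQ_apply, Submodule.mkQ_apply,
      Submodule.mkQ_apply, Submodule.Quotient.eq, Submodule.Quotient.eq] at hc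
    exact ⟨-(c * y - a), M.neg_mem hc.1, -(-(c * x) - b), M.neg_mem hc.2, by ring⟩

theorem ringQuotLength_span_pair_mul [IsLocalRing R] [IsNoetherianRing R] {x y : R}
    (h : IsRegularPair x y) {J : Ideal R} (hJ : J = Ideal.span {x, y})
    (hJm : ContainsMaximalPow J) {M : Ideal R} (hM : ContainsMaximalPow M) :
    ringQuotLength (J * M) + ringQuotLength (M.colon (J : Set R)) =
      ringQuotLength J + 2 * ringQuotLength M := by
  have h1 := length_span_pair_quotient h hJ M
  have hc : ContainsMaximalPow (M.colon (J : Set R)) := hM.mono Ideal.le_colon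
  have h2 := length_quotient_eq_add (Ideal.mul_le_left : J * M ≤ J)
  have h3 : Module.length R (R ⧸ J * M) + Module.length R (R ⧸ M.colon (J : Set R)) =
      Module.length R (R ⧸ J) + (Module.length R (R ⧸ M) + Module.length R (R ⧸ M)) := by
    rw [h1, h2]
    ring
  rw [← (hJm.mul hM).coe_ringQuotLength, ← hc.coe_ringQuotLength, ← hJm.coe_ringQuotLength,
    ← hM.coe_ringQuotLength] at h3
  norm_cast at h3
  lia

end Koszul

/-! ### Regular pairs in a two-dimensional Cohen–Macaulay ring. -/

section RegularPair

variable {R : Type*} [CommRing R] [IsLocalRing R]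

theorem IsCohenMacaulayLocal.exists_isRegularPair (hCM : IsCohenMacaulayLocal R)
    (hdim : ringKrullDim R = 2) :
    ∃ a ∈ maximalIdeal R, ∃ b ∈ maximalIdeal R, IsRegularPair a b ∧
      ContainsMaximalPow (Ideal.span {a, b}) := by
  obtain ⟨hN, rs, hmem, hreg, hlen⟩ := hCM
  rw [hdim] at hlen
  have hl : rs.length = 2 := by exact_mod_cast hlen
  obtain ⟨a, b, rfl⟩ := List.length_eq_two.1 hl
  -- A regular sequence drops the dimension by its length, so R/(a, b) is Artinian.
  have hd := Module.supportDim_add_length_eq_supportDim_of_isRegular _ hreg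
  rw [Module.supportDim_self_eq_ringKrullDim, hdim, smul_eq_mul, Ideal.mul_top,
    Module.supportDim_quotient_eq_ringKrullDim] at hd
  have hJ : Ideal.ofList [a, b] = Ideal.span {a, b} := by
    rw [Ideal.ofList_cons, Ideal.ofList_singleton, Ideal.span_insert]
  rw [hJ] at hd
  have ha : a ∈ maximalIdeal R := hmem a (by simp)
  have hb : b ∈ maximalIdeal R := hmem b (by simp)
  refine ⟨a, ha, b, hb, ⟨?_, ?_⟩, ?_⟩
  · have h := ((RingTheory.Sequence.isRegular_cons_iff _ _ _).1 hreg).1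
    exact fun z hz => h.right_eq_zero_of_smul hz
  · have h := ((RingTheory.Sequence.isRegular_cons_iff _ _ _).1
      ((RingTheory.Sequence.isRegular_cons_iff _ _ _).1 hreg).2).1
    rw [isSMulRegular_quotient_iff_mem_of_smul_mem] at h
    intro z hz
    have := h z (by
      rw [← Submodule.ideal_span_singleton_smul, smul_eq_mul, Ideal.mul_top, smul_eq_mul]
      exact Ideal.mem_span_singleton.2 hz)
    rwa [← Submodule.ideal_span_singleton_smul, smul_eq_mul, Ideal.mul_top,
      Ideal.mem_span_singleton] at this
  · have hne : Ideal.span {a, b} ≠ (⊤ : Ideal R) := by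
      intro h
      have h2 : Ideal.span {a, b} ≤ maximalIdeal R := Ideal.span_le.2 (by
        rintro z (rfl | rfl)
        · exact ha
        · exact hb)
      exact (maximalIdeal.isMaximal R).ne_top (top_le_iff.1 (h ▸ h2))
    have : Nontrivial (R ⧸ (Ideal.span {a, b} : Ideal R)) := Ideal.Quotient.nontrivial_iff.2 hne
    have h0 : ringKrullDim (R ⧸ (Ideal.span {a, b} : Ideal R)) = 0 := by
      have h2 : ringKrullDim (R ⧸ (Ideal.span {a, b} : Ideal R)) + 2 = 0 + 2 := by
        rw [zero_add]
        simpa using hd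
      exact ENat.WithBot.add_natCast_cancel.1 h2
    have : Ring.KrullDimLE 0 (R ⧸ (Ideal.span {a, b} : Ideal R)) :=
      (Ring.krullDimLE_iff).2 (by simp [h0])
    have : IsArtinianRing (R ⧸ (Ideal.span {a, b} : Ideal R)) :=
      IsNoetherianRing.isArtinianRing_of_krullDimLE_zero
    exact exists_maximalIdeal_pow_le_of_isArtinianRing_quotient _

/-- In a local ring of depth two, the quotient by a regular element has positive depth. -/
theorem IsRegularPair.dvd_of_forall_dvd_mul {a b : R} (h : IsRegularPair a b)
    (ha : a ∈ maximalIdeal R) (hb : b ∈ maximalIdeal R) {x : R} (hx : ∀ z, x * z = 0 → z = 0)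
    {z : R} (hz : ∀ c ∈ maximalIdeal R, x ∣ z * c) : x ∣ z := by
  obtain ⟨w, hw⟩ := hz a ha
  obtain ⟨v, hv⟩ := hz b hb
  -- Both sides agree after multiplication by the regular element x. Then a divides b w, hence w,
  -- and a cancels from za = xw.
  have h1 : w * b = v * a := by
    have := hx (w * b - v * a) (by linear_combination -b * hw + a * hv)
    linear_combination this
  obtain ⟨w', rfl⟩ := h.2 w ⟨v, by linear_combination h1⟩
  refine ⟨w', ?_⟩
  have := h.1 (z - x * w') (by linear_combination hw)
  linear_combination this

theorem IsRegularPair.dvd_of_pow {a b : R} (h : IsRegularPair a b)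
    (ha : a ∈ maximalIdeal R) (hb : b ∈ maximalIdeal R) {x : R} (hx : ∀ z, x * z = 0 → z = 0)
    (k : ℕ) : ∀ z, (∀ c ∈ maximalIdeal R ^ k, x ∣ z * c) → x ∣ z := by
  induction k with
  | zero =>
    intro z hz
    simpa using hz 1 (by simp)
  | succ k ih =>
    intro z hz
    refine ih z fun c hc => ?_
    refine h.dvd_of_forall_dvd_mul ha hb hx fun d hd => ?_
    rw [mul_assoc]
    exact hz _ (by rw [pow_succ]; exact Ideal.mul_mem_mul hc hd)

/-- Two generators of an `𝔪`-primary ideal in a local ring of depth two can be modified to form a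
regular pair. -/
theorem IsRegularPair.exists_of_span_pair [IsNoetherianRing R] [Infinite (ResidueField R)]
    {a b : R} (h : IsRegularPair a b) (ha : a ∈ maximalIdeal R) (hb : b ∈ maximalIdeal R) {x y : R}
    (hm : ContainsMaximalPow (Ideal.span {x, y})) :
    ∃ x' y', IsRegularPair x' y' ∧ (Ideal.span {x, y} : Ideal R) = Ideal.span {x', y'} := by
  classical
  obtain ⟨k, hk⟩ := hm
  -- Such a P would contain the maximal ideal, so the element with annihilator P would be killed by
  -- the regular element a.
  have hAss : ∀ P ∈ associatedPrimes R R, ¬ (Ideal.span {x, y} ≤ P) := by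
    intro P hP hle
    have hPp : P.IsPrime := hP.isPrime
    have hmP : maximalIdeal R ≤ P := hPp.le_of_pow_le (hk.trans hle)
    obtain ⟨-, z, hz⟩ := isAssociatedPrime_iff.1 hP
    have ha0 : a * z = 0 := by
      have := hmP ha
      rw [hz, Submodule.mem_colon_singleton] at this
      simpa using this
    have hz0 : z = 0 := h.1 z ha0
    apply hPp.ne_top
    rw [hz, hz0]
    simp
  have hfin : (associatedPrimes R R).Finite := associatedPrimes.finite R R
  let σ : ResidueField R → R := Function.surjInv residue_surjective
  have hσ : ∀ t, residue R (σ t) = t := Function.surjInv_eq residue_surjective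
  -- Prime avoidance: two residue classes bad for the same P would put both x and y into P, so each
  -- of the finitely many P excludes at most one class.
  have hbad : (⋃ P ∈ associatedPrimes R R, {t : ResidueField R | x + σ t * y ∈ P}).Finite := by
    refine hfin.biUnion fun P hP => Set.Subsingleton.finite ?_
    intro s hs t ht
    by_contra hst
    have hPp : P.IsPrime := hP.isPrime
    have hu : IsUnit (σ s - σ t) := by
      rw [← residue_ne_zero_iff_isUnit, map_sub, hσ, hσ, sub_ne_zero]
      exact hst
    have hy : y ∈ P := by
      have h1 : (σ s - σ t) * y ∈ P := by
        have := P.sub_mem hs ht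
        convert this using 1
        ring
      exact (hPp.mem_or_mem h1).resolve_left fun h2 => hPp.ne_top (P.eq_top_of_isUnit_mem h2 hu)
    have hx : x ∈ P := by
      have := P.sub_mem hs (P.mul_mem_left (σ s) hy)
      simpa using this
    refine hAss P hP (Ideal.span_le.2 ?_)
    rintro z (rfl | rfl)
    · exact hx
    · exact hy
  obtain ⟨t, ht⟩ := hbad.infinite_compl.nonempty
  have hspan : (Ideal.span {x, y} : Ideal R) = Ideal.span {x + σ t * y, y} := by
    rw [Ideal.span_pair_add_mul_right]
  have hreg : ∀ z, (x + σ t * y) * z = 0 → z = 0 := by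
    intro z hz
    by_contra hz0
    have h1 : x + σ t * y ∈ ⋃ P ∈ associatedPrimes R R, (P : Set R) := by
      rw [biUnion_associatedPrimes_eq_zero_divisors]
      exact ⟨z, hz0, hz⟩
    simp only [Set.mem_iUnion] at h1
    obtain ⟨P, hP, hxP⟩ := h1
    exact ht (Set.mem_biUnion hP hxP)
  refine ⟨x + σ t * y, y, ⟨hreg, fun z hz => ?_⟩, hspan⟩
  -- If the new first generator divides y z, it divides z c for every c in the ideal of the pair,
  -- hence for every c in a power of the maximal ideal; depth two then gives divisibility of z.
  refine h.dvd_of_pow ha hb hreg k z fun c hc => ?_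
  have hc := hk hc
  rw [hspan, Ideal.mem_span_pair] at hc
  obtain ⟨r, s, rfl⟩ := hc
  rw [mul_add]
  refine dvd_add ⟨z * r, by ring⟩ ?_
  obtain ⟨w, hw⟩ := hz
  exact ⟨s * w, by linear_combination s * hw⟩

end RegularPair

/-! ### Reductions. -/

section Reduction

variable {R : Type*} [CommRing R]

/-- Modulo J' the ideal J is generated by x, so only the pure power of x escapes J' J^n. -/
theorem pow_succ_le_mul_pow_sup_span {J J' : Ideal R} {x : R} (hx : x ∈ J)
    (h : J ≤ J' ⊔ Ideal.span {x}) (n : ℕ) :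
    J ^ (n + 1) ≤ J' * J ^ n ⊔ Ideal.span {x ^ (n + 1)} := by
  induction n with
  | zero => simpa using h
  | succ n ih =>
    calc J ^ (n + 1 + 1) = J * J ^ (n + 1) := pow_succ' _ _
      _ ≤ (J' ⊔ Ideal.span {x}) * J ^ (n + 1) := Ideal.mul_mono_left h
      _ = J' * J ^ (n + 1) ⊔ Ideal.span {x} * J ^ (n + 1) := Ideal.sup_mul _ _ _
      _ ≤ _ := sup_le le_sup_left ?_
    calc Ideal.span {x} * J ^ (n + 1) ≤
          Ideal.span {x} * (J' * J ^ n ⊔ Ideal.span {x ^ (n + 1)}) := Ideal.mul_mono_right ih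
      _ = Ideal.span {x} * (J' * J ^ n) ⊔ Ideal.span {x} * Ideal.span {x ^ (n + 1)} :=
        Ideal.mul_sup _ _ _
      _ ≤ _ := sup_le_sup ?_ ?_
    · rw [pow_succ' J n, mul_left_comm]
      exact Ideal.mul_mono_right (Ideal.mul_mono_left ((Ideal.span_singleton_le_iff_mem _).2 hx))
    · rw [Ideal.span_singleton_mul_span_singleton, ← pow_succ']

theorem IsReduction.trans {J' J I : Ideal R} (h : IsReduction J I) (hle : J' ≤ J) {n : ℕ}
    (hn : J ^ (n + 1) = J' * J ^ n) : IsReduction J' I := by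
  obtain ⟨hJI, k, hk⟩ := h
  have hs : ∀ s, I ^ (k + s) = J ^ s * I ^ k := by
    intro s
    induction s with
    | zero => simp
    | succ s ih =>
      calc I ^ (k + (s + 1)) = I ^ (k + s) * I := by rw [← add_assoc, pow_succ]
        _ = J ^ s * I ^ (k + 1) := by rw [ih, mul_assoc, ← pow_succ]
        _ = J ^ (s + 1) * I ^ k := by rw [hk, ← mul_assoc, ← pow_succ]
  refine ⟨hle.trans hJI, k + n, ?_⟩
  rw [add_assoc, hs, hn, mul_assoc, ← hs]

end Reduction

/-! ### Nonvanishing of polynomials over an infinite residue field. -/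

section NonVanishing

theorem exists_sum_mul_pow_ne_zero {k : Type*} [Field k] [Infinite k] {c : ℕ → k} {N i : ℕ}
    (hi : i < N) (hc : c i ≠ 0) : ∃ u : k, ∑ i ∈ Finset.range N, c i * u ^ i ≠ 0 := by
  by_contra! H
  have h0 : (∑ i ∈ Finset.range N, Polynomial.C (c i) * Polynomial.X ^ i) = 0 :=
    Polynomial.funext fun u => by
      simpa [Polynomial.eval_finsetSum] using H u
  have h1 := congrArg (fun p => Polynomial.coeff p i) h0
  simp only [Polynomial.finsetSum_coeff, Polynomial.coeff_C_mul_X_pow, Polynomial.coeff_zero,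
    Finset.sum_ite_eq, Finset.mem_range, hi, if_true] at h1
  exact hc h1

theorem exists_isUnit_sum_mul_pow {R : Type*} [CommRing R] [IsLocalRing R]
    [Infinite (ResidueField R)] {c : ℕ → ℕ → R} {N i j : ℕ} (hi : i < N) (hj : j < N)
    (hc : IsUnit (c i j)) :
    ∃ u v : R, IsUnit (∑ i ∈ Finset.range N, ∑ j ∈ Finset.range N, c i j * u ^ i * v ^ j) := by
  obtain ⟨u, hu⟩ := exists_sum_mul_pow_ne_zero (c := fun i => residue R (c i j)) hi
    ((residue_ne_zero_iff_isUnit _).2 hc)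
  obtain ⟨v, hv⟩ := exists_sum_mul_pow_ne_zero
    (c := fun j => ∑ i ∈ Finset.range N, residue R (c i j) * u ^ i) hj hu
  obtain ⟨u, rfl⟩ := residue_surjective u
  obtain ⟨v, rfl⟩ := residue_surjective v
  refine ⟨u, v, (residue_ne_zero_iff_isUnit _).1 ?_⟩
  rw [Finset.sum_comm]
  simpa [Finset.sum_mul] using hv

end NonVanishing

/-! ### Removing a generator by a generic linear substitution. -/

section Generators

variable {R : Type*} [CommRing R]

/-- Replacing the factors a by b one at a time costs a factor a - b in J' at each step. -/
theorem pow_mul_sub_pow_mul_mem {J J' : Ideal R} {a b : R} (ha : a ∈ J) (hb : b ∈ J)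
    (hab : a - b ∈ J') {n : ℕ} (i : ℕ) : ∀ (t : ℕ) (w : R), w ∈ J ^ t → i + t = n + 1 →
      a ^ i * w - b ^ i * w ∈ J' * J ^ n := by
  induction i with
  | zero => simp
  | succ i ih =>
    intro t w hw hit
    have h1 := ih (t + 1) (a * w) (by rw [pow_succ']; exact Ideal.mul_mem_mul ha hw) (by lia)
    have h2 : b ^ i * w ∈ J ^ n := by
      have : n = i + t := by lia
      rw [this, pow_add]
      exact Ideal.mul_mem_mul (Ideal.pow_mem_pow hb i) hw
    have h3 := Ideal.add_mem _ h1 (Ideal.mul_mem_mul hab h2)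
    convert h3 using 1
    ring

theorem mul_pow_mem_pow {J : Ideal R} {x y : R} (hx : x ∈ J) (hy : y ∈ J) (i j : ℕ) :
    x ^ i * y ^ j ∈ J ^ (i + j) := by
  rw [pow_add]
  exact Ideal.mul_mem_mul (Ideal.pow_mem_pow hx i) (Ideal.pow_mem_pow hy j)

/-- A form of degree `n + 1` in three elements, with a unit among the coefficients, that takes a
value in `𝔪 J ^ (n + 1)` yields a reduction of `J` with one generator less. -/
theorem exists_pow_succ_eq_mul_pow_of_sum_mem [IsLocalRing R] [IsNoetherianRing R]
    [Infinite (ResidueField R)] {J J₀ : Ideal R} {x y z : R}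
    (hJ : J = J₀ ⊔ Ideal.span {x, y, z}) {N n : ℕ} (hn : 2 * N ≤ n + 3) (c : ℕ → ℕ → R)
    (hsum : ∑ i ∈ Finset.range N, ∑ j ∈ Finset.range N, c i j * (x ^ i * (y ^ j * z ^ (n + 1 - i - j)))
      ∈ maximalIdeal R * J ^ (n + 1)) {i j : ℕ} (hi : i < N) (hj : j < N) (hc : IsUnit (c i j)) :
    ∃ u v : R, J ^ (n + 1) = (J₀ ⊔ Ideal.span {x - u * z, y - v * z}) * J ^ n := by
  obtain ⟨u, v, huv⟩ := exists_isUnit_sum_mul_pow hi hj hc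
  refine ⟨u, v, ?_⟩
  set J' := J₀ ⊔ Ideal.span {x - u * z, y - v * z} with hJ'
  have hxJ : x ∈ J := hJ ▸ Ideal.mem_sup_right (Ideal.subset_span (by simp))
  have hyJ : y ∈ J := hJ ▸ Ideal.mem_sup_right (Ideal.subset_span (by simp))
  have hzJ : z ∈ J := hJ ▸ Ideal.mem_sup_right (Ideal.subset_span (by simp))
  have hx' : x - u * z ∈ J' := Ideal.mem_sup_right (Ideal.subset_span (by simp))
  have hy' : y - v * z ∈ J' := Ideal.mem_sup_right (Ideal.subset_span (by simp))
  have hJ'J : J' ≤ J := by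
    refine sup_le (hJ ▸ le_sup_left) (Ideal.span_le.2 ?_)
    rintro w (rfl | rfl)
    · exact J.sub_mem hxJ (J.mul_mem_left u hzJ)
    · exact J.sub_mem hyJ (J.mul_mem_left v hzJ)
  have hJle : J ≤ J' ⊔ Ideal.span {z} := by
    have hz : z ∈ J' ⊔ Ideal.span {z} := Ideal.mem_sup_right (Ideal.mem_span_singleton_self z)
    rw [hJ]
    refine sup_le (le_sup_left.trans le_sup_left) (Ideal.span_le.2 ?_)
    rintro w (rfl | rfl | rfl)
    · have := Ideal.add_mem _ (Ideal.mem_sup_left hx') (Ideal.mul_mem_left _ u hz)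
      simpa using this
    · have := Ideal.add_mem _ (Ideal.mem_sup_left hy') (Ideal.mul_mem_left _ v hz)
      simpa using this
    · exact hz
  -- Modulo J' one may substitute x = uz and y = vz. The bound on N keeps i + j ≤ n + 1, so the
  -- truncated exponent of z is exact.
  have hterm : ∀ i < N, ∀ j < N,
      x ^ i * (y ^ j * z ^ (n + 1 - i - j)) - u ^ i * v ^ j * z ^ (n + 1) ∈ J' * J ^ n := by
    intro i hi j hj
    have h1 := pow_mul_sub_pow_mul_mem hxJ (J.mul_mem_left u hzJ) hx' (n := n) i
      (j + (n + 1 - i - j)) _ (mul_pow_mem_pow hyJ hzJ j (n + 1 - i - j)) (by lia)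
    have h2 := pow_mul_sub_pow_mul_mem hyJ (J.mul_mem_left v hzJ) hy' (n := n) j
      (i + (n + 1 - i - j)) _ (mul_pow_mem_pow (J.mul_mem_left u hzJ) hzJ i (n + 1 - i - j))
      (by lia)
    have h3 := Ideal.add_mem _ h1 h2
    have h4 : z ^ (n + 1) = z ^ i * z ^ j * z ^ (n + 1 - i - j) := by
      rw [← pow_add, ← pow_add]
      congr 1
      lia
    rw [h4]
    convert h3 using 1
    ring
  have hz : z ^ (n + 1) ∈ J' * J ^ n ⊔ maximalIdeal R * J ^ (n + 1) := by
    have h1 : ∑ i ∈ Finset.range N, ∑ j ∈ Finset.range N,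
        c i j * (x ^ i * (y ^ j * z ^ (n + 1 - i - j)) - u ^ i * v ^ j * z ^ (n + 1)) ∈ J' * J ^ n :=
      Ideal.sum_mem _ fun i hi => Ideal.sum_mem _ fun j hj =>
        Ideal.mul_mem_left _ _ (hterm i (Finset.mem_range.1 hi) j (Finset.mem_range.1 hj))
    have h2 : (∑ i ∈ Finset.range N, ∑ j ∈ Finset.range N, c i j * u ^ i * v ^ j) * z ^ (n + 1) ∈
        J' * J ^ n ⊔ maximalIdeal R * J ^ (n + 1) := by
      have h3 := Ideal.sub_mem _ (Ideal.mem_sup_right hsum) (Ideal.mem_sup_left h1)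
      convert h3 using 1
      rw [← Finset.sum_sub_distrib, Finset.sum_mul]
      refine Finset.sum_congr rfl fun i _ => ?_
      rw [← Finset.sum_sub_distrib, Finset.sum_mul]
      refine Finset.sum_congr rfl fun j _ => ?_
      ring
    exact (Ideal.unit_mul_mem_iff_mem _ huv).1 h2
  refine le_antisymm ?_ (by rw [pow_succ']; exact Ideal.mul_mono_left hJ'J)
  -- Nakayama: the form evaluates to a unit times z^(n+1), so J^(n+1) lies in J' J^n up to the
  -- maximal ideal times itself.
  refine Submodule.le_of_le_smul_of_le_jacobson_bot (I := maximalIdeal R)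
    (IsNoetherian.noetherian _) (maximalIdeal_le_jacobson _) ?_
  exact (pow_succ_le_mul_pow_sup_span hzJ hJle n).trans
    (sup_le le_sup_left ((Ideal.span_singleton_le_iff_mem _).2 hz))

end Generators

/-! ### Growth of λ(R/J^n) and the number of generators of a minimal reduction. -/

section Growth

variable {R : Type*} [CommRing R] [IsLocalRing R] [IsNoetherianRing R]

/-- Independence modulo 𝔪P makes each adjunction of some w i to 𝔪P a strict enlargement. -/
theorem ringQuotLength_add_card_le {P : Ideal R} (hP : ContainsMaximalPow P) {ι : Type*}
    [Fintype ι] (w : ι → R) (hw : ∀ i, w i ∈ P)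
    (hind : ∀ c : ι → R, ∑ i, c i * w i ∈ maximalIdeal R * P → ∀ i, ¬ IsUnit (c i)) :
    ringQuotLength P + Fintype.card ι ≤ ringQuotLength (maximalIdeal R * P) := by
  classical
  have hmP : ContainsMaximalPow (maximalIdeal R * P) := .mul ⟨1, by simp⟩ hP
  have key : ∀ s : Finset ι,
      ringQuotLength (maximalIdeal R * P ⊔ Ideal.span (w '' s)) + s.card ≤
        ringQuotLength (maximalIdeal R * P) := by
    intro s
    induction s using Finset.induction_on with
    | empty => simp
    | insert i s his ih =>
      have hlt : maximalIdeal R * P ⊔ Ideal.span (w '' s) <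
          maximalIdeal R * P ⊔ Ideal.span (w '' (insert i s : Finset ι)) := by
        refine lt_of_le_of_ne (sup_le_sup_left (Ideal.span_mono
          (Set.image_mono (by simp))) _) fun heq => ?_
        have hi : w i ∈ maximalIdeal R * P ⊔ Ideal.span (w '' s) :=
          heq ▸ Ideal.mem_sup_right (Ideal.subset_span ⟨i, by simp, rfl⟩)
        obtain ⟨p, hp, q, hq, hpq⟩ := Submodule.mem_sup.1 hi
        obtain ⟨c, hc⟩ := (Submodule.mem_span_image_finset_iff_exists_fun' R).1 hq
        refine hind (fun j => if j = i then 1 else if j ∈ s then -c j else 0) ?_ i (by simp)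
        have : ∑ j, (if j = i then 1 else if j ∈ s then -c j else 0) * w j = p := by
          rw [← Finset.add_sum_erase _ _ (Finset.mem_univ i)]
          have h1 : ∑ j ∈ Finset.univ.erase i,
              (if j = i then 1 else if j ∈ s then -c j else 0) * w j =
              ∑ j ∈ s, -(c j * w j) := by
            symm
            refine Finset.sum_subset_zero_on_sdiff ?_ ?_ ?_
            · intro j hj
              exact Finset.mem_erase.2 ⟨fun h => his (h ▸ hj), Finset.mem_univ j⟩
            · intro j hj
              rw [Finset.mem_sdiff, Finset.mem_erase] at hj
              simp [hj.1.1, hj.2]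
            · intro j hj
              have : j ≠ i := fun h => his (h ▸ hj)
              simp [this, hj]
          rw [h1, Finset.sum_neg_distrib, if_pos rfl, one_mul]
          simp only [smul_eq_mul] at hc
          rw [hc, ← hpq]
          ring
        rw [this]
        exact hp
      have := ringQuotLength_strictAnti (hmP.mono le_sup_left) hlt
      rw [Finset.card_insert_of_notMem his]
      lia
  have h1 := key Finset.univ
  have h2 : maximalIdeal R * P ⊔ Ideal.span (w '' (Finset.univ : Finset ι)) ≤ P :=
    sup_le Ideal.mul_le_right (Ideal.span_le.2 (by rintro _ ⟨i, -, rfl⟩; exact hw i))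
  have h3 := ringQuotLength_anti (hmP.mono le_sup_left) h2
  rw [Finset.card_univ] at h1
  lia

/-- The quotient of N + (w) by N is cyclic and killed by Q, hence an image of R/Q. -/
theorem ringQuotLength_le_add_of_mul_le {N Q : Ideal R} (hN : ContainsMaximalPow N)
    (hQ : ContainsMaximalPow Q) {w : R} (hw : ∀ r ∈ Q, r * w ∈ N) :
    ringQuotLength N ≤ ringQuotLength (N ⊔ Ideal.span {w}) + ringQuotLength Q := by
  have h1 := quotLength_add_ringQuotLength hN (le_sup_left : N ≤ N ⊔ Ideal.span {w})
  have hwm : w ∈ N ⊔ Ideal.span {w} := Ideal.mem_sup_right (Ideal.mem_span_singleton_self w)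
  let f₁ : R →ₗ[R] (N ⊔ Ideal.span {w} : Ideal R) ⧸ N.submoduleOf (N ⊔ Ideal.span {w}) :=
    (N.submoduleOf (N ⊔ Ideal.span {w})).mkQ ∘ₗ
      LinearMap.toSpanSingleton R (N ⊔ Ideal.span {w} : Ideal R) ⟨w, hwm⟩
  have hf₁ : Q ≤ LinearMap.ker f₁ := by
    intro r hr
    rw [LinearMap.mem_ker]
    exact (Submodule.Quotient.mk_eq_zero _).2 (hw r hr)
  have hs : Function.Surjective (Submodule.liftQ Q f₁ hf₁) := by
    intro z
    obtain ⟨⟨z, hz⟩, rfl⟩ := Submodule.mkQ_surjective _ z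
    obtain ⟨p, hp, q, hq, rfl⟩ := Submodule.mem_sup.1 hz
    obtain ⟨r, rfl⟩ := Ideal.mem_span_singleton'.1 hq
    refine ⟨Q.mkQ r, (Submodule.Quotient.eq _).2 ?_⟩
    change r * w - (p + r * w) ∈ N
    have := N.neg_mem hp
    convert this using 1
    ring
  have h2 : quotLength (N ⊔ Ideal.span {w}) N ≤ ringQuotLength Q :=
    ENat.toNat_le_toNat (Module.length_le_of_surjective _ hs) hQ.length_ne_top
  lia

theorem ringQuotLength_mul_span_le {Q : Ideal R} (hQ : ContainsMaximalPow Q) (s : Finset R)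
    (hs : ContainsMaximalPow (Ideal.span (s : Set R))) :
    ringQuotLength (Q * Ideal.span (s : Set R)) ≤
      ringQuotLength (Ideal.span (s : Set R)) + s.card * ringQuotLength Q := by
  classical
  have hQs := hQ.mul hs
  have key : ∀ t : Finset R, t ⊆ s → ringQuotLength (Q * Ideal.span (s : Set R)) ≤
      ringQuotLength (Q * Ideal.span (s : Set R) ⊔ Ideal.span (t : Set R)) +
        t.card * ringQuotLength Q := by
    intro t
    induction t using Finset.induction_on with
    | empty => simp
    | insert w t hwt ih =>
      intro hts
      have h1 := ih ((Finset.subset_insert w t).trans hts)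
      have h2 := ringQuotLength_le_add_of_mul_le
        (N := Q * Ideal.span (s : Set R) ⊔ Ideal.span (t : Set R)) (hQs.mono le_sup_left) hQ
        (w := w) fun r hr => Ideal.mem_sup_left (Ideal.mul_mem_mul hr
          (Ideal.subset_span (hts (Finset.mem_insert_self w t))))
      rw [Finset.coe_insert, Ideal.span_insert, Finset.card_insert_of_notMem hwt,
        sup_comm (Ideal.span {w}), ← sup_assoc, add_mul]
      lia
  have h1 := key s le_rfl
  rwa [sup_eq_right.2 Ideal.mul_le_right] at h1

theorem exists_finset_span_eq_pow {R : Type*} [CommRing R] (a b : R) (n : ℕ) :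
    ∃ s : Finset R, s.card ≤ n + 1 ∧ Ideal.span (s : Set R) = Ideal.span {a, b} ^ n := by
  classical
  induction n with
  | zero => exact ⟨{1}, by simp, by simp⟩
  | succ n ih =>
    obtain ⟨s, hs, hsp⟩ := ih
    have hb : b ∈ Ideal.span {a, b} := Ideal.subset_span (by simp)
    have ha : Ideal.span {a} ≤ Ideal.span {a, b} := Ideal.span_mono (by simp)
    refine ⟨insert (b ^ (n + 1)) (s.image (a * ·)), ?_, ?_⟩
    · have h1 := Finset.card_insert_le (b ^ (n + 1)) (s.image (a * ·))
      have h2 := Finset.card_image_le (s := s) (f := (a * ·))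
      lia
    · have h1 : Ideal.span ((insert (b ^ (n + 1)) (s.image (a * ·)) : Finset R) : Set R) =
          Ideal.span {a} * Ideal.span {a, b} ^ n ⊔ Ideal.span {b ^ (n + 1)} := by
        rw [Finset.coe_insert, Ideal.span_insert, Finset.coe_image, sup_comm, ← hsp,
          Ideal.span_mul_span', Set.singleton_mul]
      rw [h1]
      refine le_antisymm (sup_le ?_ ?_) (pow_succ_le_mul_pow_sup_span hb ?_ n)
      · rw [pow_succ']
        exact Ideal.mul_mono_left ha
      · exact (Ideal.span_singleton_le_iff_mem _).2 (Ideal.pow_mem_pow hb _)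
      · rw [← Ideal.span_insert]

theorem ringQuotLength_pow_span_pair_le {a b : R} (h : ContainsMaximalPow (Ideal.span {a, b}))
    (n : ℕ) : ringQuotLength (Ideal.span {a, b} ^ n) ≤
      ringQuotLength (Ideal.span {a, b}) * n ^ 2 := by
  induction n with
  | zero =>
    simp [Ideal.one_eq_top, ringQuotLength_top]
  | succ n ih =>
    obtain ⟨s, hs, hsp⟩ := exists_finset_span_eq_pow a b n
    have h1 := ringQuotLength_mul_span_le h s (hsp ▸ h.pow n)
    rw [hsp, ← pow_succ'] at h1
    have h2 := Nat.mul_le_mul_right (ringQuotLength (Ideal.span {a, b})) hs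
    rcases n with _ | n
    · simp
    · nlinarith

/-- A minimal reduction of an `𝔪`-primary ideal of a two-dimensional Cohen–Macaulay local ring with
infinite residue field has two generators. -/
theorem IsMinimalReduction.exists_span_pair [Infinite (ResidueField R)] {a b : R}
    (ha : a ∈ maximalIdeal R) (hb : b ∈ maximalIdeal R)
    (hab : ContainsMaximalPow (Ideal.span {a, b})) {I J : Ideal R} (hJ : IsMinimalReduction J I)
    (hJm : ContainsMaximalPow J) (hJ1 : J ≤ maximalIdeal R) : ∃ x y, J = Ideal.span {x, y} := by
  classical
  have hex : ∃ n, ∃ s : Finset R, s.card = n ∧ Ideal.span (s : Set R) = J := by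
    obtain ⟨s, hs⟩ := IsNoetherian.noetherian J
    exact ⟨_, s, rfl, hs⟩
  obtain ⟨s, hsn, hs⟩ := Nat.find_spec hex
  have hmin : ∀ t : Finset R, Ideal.span (t : Set R) = J → s.card ≤ t.card := fun t ht => by
    rw [hsn]
    exact Nat.find_min' hex ⟨t, rfl, ht⟩
  by_cases h2 : s.card ≤ 2
  · obtain h | h | h : s.card = 0 ∨ s.card = 1 ∨ s.card = 2 := by lia
    · rw [Finset.card_eq_zero] at h
      subst h
      exact ⟨0, 0, by simp [← hs]⟩
    · obtain ⟨x, rfl⟩ := Finset.card_eq_one.1 h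
      exact ⟨x, x, by simp [← hs]⟩
    · obtain ⟨x, y, -, rfl⟩ := Finset.card_eq_two.1 h
      exact ⟨x, y, by simp [← hs]⟩
  exfalso
  obtain ⟨x, y, z, hx, hy, hz, hxy, hxz, hyz⟩ := Finset.two_lt_card_iff.1 (not_le.1 h2)
  set J₀ : Ideal R := Ideal.span (s \ {x, y, z} : Finset R)
  have hJ₀ : J = J₀ ⊔ Ideal.span {x, y, z} := by
    have h3 : ({x, y, z} : Set R) = (({x, y, z} : Finset R) : Set R) := by simp
    rw [← hs, h3, ← Ideal.span_union, ← Finset.coe_union, Finset.sdiff_union_of_subset]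
    intro w hw
    simp only [Finset.mem_insert, Finset.mem_singleton] at hw
    rcases hw with rfl | rfl | rfl <;> assumption
  have hxJ : x ∈ J := hJ₀ ▸ Ideal.mem_sup_right (Ideal.subset_span (by simp))
  have hyJ : y ∈ J := hJ₀ ▸ Ideal.mem_sup_right (Ideal.subset_span (by simp))
  have hzJ : z ∈ J := hJ₀ ▸ Ideal.mem_sup_right (Ideal.subset_span (by simp))
  -- Such an ideal would be a reduction of I inside J, hence equal to J by minimality, yet it has
  -- one generator fewer than the smallest generating set s.
  have hnored : ∀ (u v : R) (n : ℕ),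
      J ^ (n + 1) ≠ (J₀ ⊔ Ideal.span {x - u * z, y - v * z}) * J ^ n := by
    intro u v n heq
    have hle : J₀ ⊔ Ideal.span {x - u * z, y - v * z} ≤ J := by
      refine sup_le (le_sup_left.trans hJ₀.ge) (Ideal.span_le.2 ?_)
      rintro w (rfl | rfl)
      · exact J.sub_mem hxJ (J.mul_mem_left u hzJ)
      · exact J.sub_mem hyJ (J.mul_mem_left v hzJ)
    have h3 := hmin ((s \ {x, y, z}) ∪ {x - u * z, y - v * z}) (by
      rw [Finset.coe_union, Ideal.span_union, Finset.coe_pair]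
      exact le_antisymm hle (hJ.2 (hJ.1.trans hle heq) hle))
    have h4 := Finset.card_union_le (s \ {x, y, z}) {x - u * z, y - v * z}
    have h5 := Finset.card_le_two (a := x - u * z) (b := y - v * z)
    have h6 : (s \ {x, y, z}).card + ({x, y, z} : Finset R).card = s.card :=
      Finset.card_sdiff_add_card_eq_card (by
        intro w hw
        simp only [Finset.mem_insert, Finset.mem_singleton] at hw
        rcases hw with rfl | rfl | rfl <;> assumption)
    have h7 : ({x, y, z} : Finset R).card = 3 := Finset.card_eq_three.2
      ⟨x, y, z, hxy, hxz, hyz, rfl⟩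
    lia
  -- The (m + 1)² monomials of degree 2m with x- and y-exponents at most m are independent modulo 𝔪
  -- J^(2m), since a relation would produce a forbidden reduction. The summand 1 on the right
  -- absorbs m = 0, where the argument on forms of positive degree does not apply.
  have hstep : ∀ m, ringQuotLength (J ^ (2 * m)) + (m + 1) ^ 2 ≤
      ringQuotLength (J ^ (2 * (m + 1))) + 1 := by
    intro m
    rcases m with _ | m
    · have := ringQuotLength_anti (hJm.pow (2 * (0 + 1))) (Ideal.pow_le_pow_right (Nat.zero_le _))
      simpa using this
    have h3 := ringQuotLength_add_card_le (hJm.pow (2 * (m + 1)))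
      (ι := Fin (m + 2) × Fin (m + 2))
      (fun p => x ^ (p.1 : ℕ) * (y ^ (p.2 : ℕ) * z ^ (2 * m + 1 + 1 - p.1 - p.2))) ?_ ?_
    · have h4 : J ^ (2 * (m + 1 + 1)) ≤ maximalIdeal R * J ^ (2 * (m + 1)) := by
        calc J ^ (2 * (m + 1 + 1)) ≤ J ^ (2 * (m + 1) + 1) := Ideal.pow_le_pow_right (by lia)
          _ = J * J ^ (2 * (m + 1)) := pow_succ' _ _
          _ ≤ _ := Ideal.mul_mono_left hJ1
      have h5 := ringQuotLength_anti (hJm.pow _) h4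
      simp only [Fintype.card_prod, Fintype.card_fin] at h3
      nlinarith
    · rintro ⟨i, j⟩
      have h4 : 2 * (m + 1) = i + (j + (2 * m + 1 + 1 - i - j)) := by lia
      rw [h4, pow_add]
      exact Ideal.mul_mem_mul (Ideal.pow_mem_pow hxJ _) (mul_pow_mem_pow hyJ hzJ _ _)
    · rintro c hc ⟨i, j⟩ hu
      rw [show 2 * (m + 1) = 2 * m + 1 + 1 by lia] at hc
      let c' : ℕ → ℕ → R := fun i j =>
        if h : i < m + 2 ∧ j < m + 2 then c (⟨i, h.1⟩, ⟨j, h.2⟩) else 0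
      have hc' : ∀ i j : Fin (m + 2), c' i j = c (i, j) := fun i j => by simp [c']
      obtain ⟨u, v, huv⟩ := exists_pow_succ_eq_mul_pow_of_sum_mem hJ₀ (N := m + 2)
        (n := 2 * m + 1) (by lia) c' (by
          simpa [Fintype.sum_prod_type, ← hc', Finset.sum_range] using hc) i.2 j.2
        (by rw [hc']; exact hu)
      exact hnored u v _ huv
  have hlow : ∀ m, m ^ 3 ≤ 3 * ringQuotLength (J ^ (2 * m)) + 3 * m := by
    intro m
    induction m with
    | zero => simp
    | succ m ih => nlinarith [hstep m]
  obtain ⟨k, hk⟩ := hJm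
  -- J contains a two-generated ideal of finite colength, which forces quadratic growth and
  -- contradicts the cubic lower bound.
  have hq : Ideal.span {a ^ k, b ^ k} ≤ J := by
    refine (Ideal.span_le.2 ?_).trans hk
    rintro w (rfl | rfl)
    · exact Ideal.pow_mem_pow ha k
    · exact Ideal.pow_mem_pow hb k
  have hqm : ContainsMaximalPow (Ideal.span {a ^ k, b ^ k}) := by
    obtain ⟨l, hl⟩ := Ideal.exists_pow_le_of_le_radical_of_fg
      (I := Ideal.span {a, b}) (J := Ideal.span {a ^ k, b ^ k}) (by
        refine Ideal.span_le.2 ?_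
        rintro w (rfl | rfl)
        · exact ⟨k, Ideal.subset_span (by simp)⟩
        · exact ⟨k, Ideal.subset_span (by simp)⟩) (IsNoetherian.noetherian _)
    exact (hab.pow l).mono hl
  set C := ringQuotLength (Ideal.span {a ^ k, b ^ k})
  have hup : ∀ m, ringQuotLength (J ^ (2 * m)) ≤ C * (2 * m) ^ 2 := fun m =>
    (ringQuotLength_anti (hqm.pow _) (Ideal.pow_right_mono hq _)).trans
      (ringQuotLength_pow_span_pair_le hqm _)
  -- The bounds combine to m³ ≤ 12Cm² + 3m, which fails at m = 12C + 4.
  have h3 := hlow (12 * C + 4)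
  have h4 := hup (12 * C + 4)
  nlinarith

end Growth

/-! ### The Ratliff–Rush closure of the filtration K I^n. -/

section Saturation

variable {R : Type*} [CommRing R]

theorem colon_colon (N A B : Ideal R) :
    (N.colon (A : Set R)).colon (B : Set R) = N.colon ((A * B : Ideal R) : Set R) := by
  ext r
  constructor
  · intro h
    rw [Submodule.mem_colon] at h ⊢
    intro s hs
    refine Submodule.mul_induction_on hs (fun a ha b hb => ?_) fun a b ha hb => ?_
    · have := Submodule.mem_colon.1 (h b hb) a ha
      simp only [smul_eq_mul] at this ⊢
      convert this using 1
      ring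
    · rw [smul_add]
      exact N.add_mem ha hb
  · intro h
    rw [Submodule.mem_colon] at h ⊢
    intro b hb
    rw [Submodule.mem_colon]
    intro a ha
    have := h _ (Ideal.mul_mem_mul ha hb)
    simp only [smul_eq_mul] at this ⊢
    convert this using 1
    ring

theorem mul_colon_le (A N B : Ideal R) :
    A * N.colon (B : Set R) ≤ (A * N).colon (B : Set R) := by
  rw [Ideal.mul_le]
  intro a ha r hr
  rw [Submodule.mem_colon] at hr ⊢
  intro b hb
  rw [smul_eq_mul, mul_assoc]
  exact Ideal.mul_mem_mul ha (hr b hb)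

theorem IsReduction.exists_mul_pow_succ_eq {J I : Ideal R} (h : IsReduction J I) (K : Ideal R) :
    ∃ n₀, ∀ n ≥ n₀, K * I ^ (n + 1) = J * (K * I ^ n) := by
  obtain ⟨-, k, hk⟩ := h
  refine ⟨k, fun n hn => ?_⟩
  obtain ⟨s, rfl⟩ := Nat.exists_eq_add_of_le hn
  rw [add_right_comm, pow_add, hk, pow_add]
  ring

/-- Artin–Rees: x (K I^(n+1) : J) is a J-filtration inside the stable filtration K I^n, hence itself
stable. Cancelling the regular element x gives (K I^(n+2) : J) = J (K I^(n+1) : J), which lies in K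
I^(n+1), for large n. -/
theorem IsReduction.exists_colon_le [IsNoetherianRing R] {J I : Ideal R} (h : IsReduction J I)
    {x : R} (hxJ : x ∈ J) (hx : ∀ z, x * z = 0 → z = 0) (K : Ideal R) :
    ∃ n₀, ∀ n ≥ n₀, (K * I ^ (n + 1)).colon (J : Set R) ≤ K * I ^ n := by
  have hJI := h.1
  have hpow : ∀ n, K * I ^ (n + 1) ≤ K * I ^ n := fun n =>
    Ideal.mul_mono_right (Ideal.pow_le_pow_right (Nat.le_succ n))
  have hJpow : ∀ n, J * (K * I ^ n) ≤ K * I ^ (n + 1) := fun n => by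
    rw [mul_left_comm, pow_succ']
    exact Ideal.mul_mono_right (Ideal.mul_mono_left hJI)
  let F : J.Filtration R :=
    { N := fun n => K * I ^ n
      mono := hpow
      smul_le := hJpow }
  let F' : J.Filtration R :=
    { N := fun n => Ideal.span {x} * (K * I ^ (n + 1)).colon (J : Set R)
      mono := fun n => Ideal.mul_mono_right (Submodule.colon_mono (hpow (n + 1)) le_rfl)
      smul_le := fun n => by
        rw [smul_eq_mul, mul_left_comm]
        exact Ideal.mul_mono_right
          ((mul_colon_le _ _ _).trans (Submodule.colon_mono (hJpow _) le_rfl)) }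
  have hF : F.Stable := by
    obtain ⟨n₀, hn₀⟩ := h.exists_mul_pow_succ_eq K
    exact ⟨n₀, fun n hn => (hn₀ n hn).symm⟩
  have hle : F' ≤ F := by
    intro n
    change Ideal.span {x} * (K * I ^ (n + 1)).colon (J : Set R) ≤ K * I ^ n
    rw [Ideal.span_singleton_mul_le_iff]
    intro z hz
    have := Submodule.mem_colon.1 hz x hxJ
    rw [smul_eq_mul, mul_comm z] at this
    exact hpow n this
  obtain ⟨n₀, hn₀⟩ := hF.of_le hle
  refine ⟨n₀ + 1, fun n hn => ?_⟩
  obtain ⟨n, rfl⟩ : ∃ m, n = m + 1 := ⟨n - 1, by lia⟩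
  have h1 : J * (Ideal.span {x} * (K * I ^ (n + 1)).colon (J : Set R)) =
    Ideal.span {x} * (K * I ^ (n + 1 + 1)).colon (J : Set R) := hn₀ n (by lia)
  intro z hz
  have h2 : x * z ∈ Ideal.span {x} * (J * (K * I ^ (n + 1)).colon (J : Set R)) := by
    rw [mul_left_comm, h1]
    exact Ideal.mul_mem_mul (Ideal.mem_span_singleton_self x) hz
  obtain ⟨w, hw, hwz⟩ := Ideal.mem_span_singleton_mul.1 h2
  have h3 : z = w := by
    have := hx (z - w) (by rw [mul_sub, hwz, sub_self])
    exact sub_eq_zero.1 this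
  rw [h3]
  have h4 : J * (K * I ^ (n + 1)).colon (J : Set R) ≤ K * I ^ (n + 1) := by
    rw [Ideal.mul_le]
    intro a ha r hr
    have := Submodule.mem_colon.1 hr a ha
    rwa [smul_eq_mul, mul_comm r] at this
  exact h4 hw

/-- The properties of the Ratliff–Rush closure `L n = ⋃ k, (K I ^ (n + k) : J ^ k)` of the
filtration `K I ^ n`. -/
structure IsSaturation (J I K : Ideal R) (L : ℕ → Ideal R) : Prop where
  le : ∀ n, K * I ^ n ≤ L n
  mul_le : ∀ n, I * L n ≤ L (n + 1)
  colon_eq : ∀ n, (L (n + 1)).colon (J : Set R) = L n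
  eventually_eq : ∃ n₀, ∀ n ≥ n₀, L n = K * I ^ n

theorem IsReduction.exists_isSaturation [IsNoetherianRing R] {J I : Ideal R}
    (h : IsReduction J I) {x : R} (hxJ : x ∈ J) (hx : ∀ z, x * z = 0 → z = 0) (K : Ideal R) :
    ∃ L, IsSaturation J I K L := by
  obtain ⟨n₀, hn₀⟩ := h.exists_colon_le hxJ hx K
  have hle : ∀ n k, K * I ^ n ≤ (K * I ^ (n + k)).colon ((J ^ k : Ideal R) : Set R) := by
    intro n k r hr
    rw [Submodule.mem_colon]
    intro s hs
    rw [pow_add, ← mul_assoc, smul_eq_mul]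
    exact Ideal.mul_mem_mul hr (Ideal.pow_right_mono h.1 k hs)
  have hn₀' : ∀ n ≥ n₀, (K * I ^ (n + 1)).colon (J : Set R) = K * I ^ n := fun n hn =>
    le_antisymm (hn₀ n hn) (by simpa using hle n 1)
  have heq : ∀ n ≥ n₀, ∀ k,
      (K * I ^ (n + k)).colon ((J ^ k : Ideal R) : Set R) = K * I ^ n := by
    intro n hn k
    induction k with
    | zero => simp [Ideal.one_eq_top]
    | succ k ih => rw [pow_succ', ← colon_colon, ← add_assoc, hn₀' _ (by lia), ih]
  -- The colons have stabilised once the exponent reaches n₀, so this single shift works for every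
  -- n.
  refine ⟨fun n => (K * I ^ (n + n₀)).colon ((J ^ n₀ : Ideal R) : Set R), fun n => hle n n₀,
    fun n => ?_, fun n => ?_, n₀, fun n hn => heq n hn n₀⟩
  · refine (mul_colon_le _ _ _).trans (Submodule.colon_mono ?_ le_rfl)
    rw [mul_left_comm, ← pow_succ', add_right_comm]
  · rw [colon_colon, mul_comm (J ^ n₀), ← colon_colon, add_right_comm, hn₀' _ (by lia)]

end Saturation

/-! ### Hilbert coefficients and the sum of the jumps. -/

section Hilbert

theorem isHilbertCoeffs_two_iff {R : Type*} [CommRing R] {K I : Ideal R} {g : Fin 3 → ℤ} :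
    IsHilbertCoeffs 2 K I g ↔ ∀ᶠ n : ℕ in Filter.atTop,
      (ringQuotLength (K * I ^ n) : ℤ) = g 0 * ((n + 1).choose 2 : ℕ) - g 1 * n + g 2 := by
  refine Filter.eventually_congr (Filter.Eventually.of_forall fun n => ?_)
  rw [Fin.sum_univ_three]
  simp [sub_eq_add_neg]

theorem choose_add_two_two (n : ℕ) :
    (((n + 1 + 1).choose 2 : ℕ) : ℤ) = ((n + 1).choose 2 : ℕ) + (n + 1) := by
  rw [Nat.choose_succ_succ' (n + 1) 1, Nat.choose_one_right]
  push_cast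
  ring

theorem exists_eq_of_second_difference {h : ℕ → ℤ} {e : ℤ} {N : ℕ}
    (hh : ∀ n ≥ N, h (n + 2) - 2 * h (n + 1) + h n = e) :
    ∃ g₁ g₂ : ℤ, ∀ n ≥ N, h n = e * ((n + 1).choose 2 : ℕ) - g₁ * n + g₂ := by
  set g₁ := e * (N + 1) - (h (N + 1) - h N) with hg₁
  refine ⟨g₁, h N - e * ((N + 1).choose 2 : ℕ) + g₁ * N, ?_⟩
  suffices H : ∀ k, h (N + k) = e * ((N + k + 1).choose 2 : ℕ) - g₁ * (N + k : ℕ) +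
      (h N - e * ((N + 1).choose 2 : ℕ) + g₁ * N) ∧
      h (N + k + 1) - h (N + k) = e * (N + k + 1 : ℕ) - g₁ by
    intro n hn
    obtain ⟨k, rfl⟩ := Nat.exists_eq_add_of_le hn
    exact (H k).1
  intro k
  induction k with
  | zero =>
    refine ⟨by simp, ?_⟩
    rw [hg₁]
    push_cast
    ring_nf
  | succ k ih =>
    obtain ⟨h1, h2⟩ := ih
    have h3 := hh (N + k) (by lia)
    have h4 := choose_add_two_two (N + k)
    rw [← add_assoc]
    refine ⟨?_, ?_⟩
    · rw [h4]
      push_cast at h1 h2 ⊢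
      linear_combination h1 + h2
    · push_cast at h2 ⊢
      linear_combination h2 + h3

theorem eq_of_eventually_eq_quadratic {f g : Fin 3 → ℤ}
    (h : ∀ᶠ n : ℕ in Filter.atTop, f 0 * ((n + 1).choose 2 : ℕ) - f 1 * n + f 2 =
      g 0 * ((n + 1).choose 2 : ℕ) - g 1 * n + g 2) : f = g := by
  obtain ⟨n, hn⟩ := Filter.eventually_atTop.1 h
  have h0 := hn n le_rfl
  have h1 := hn (n + 1) (by lia)
  have h2 := hn (n + 2) (by lia)
  have c1 := choose_add_two_two n
  have c2 := choose_add_two_two (n + 1)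
  rw [c1] at h1
  rw [c2, c1] at h2
  push_cast at h0 h1 h2
  have e0 : f 0 = g 0 := by linear_combination h2 - 2 * h1 + h0
  rw [e0] at h0 h1
  have e1 : f 1 = g 1 := by linear_combination h0 - h1
  rw [e1] at h0
  have e2 : f 2 = g 2 := by linear_combination h0
  ext i
  fin_cases i
  · exact e0
  · exact e1
  · exact e2

variable {R : Type*} [CommRing R] {J I K : Ideal R} {L : ℕ → Ideal R}

theorem eventually_eq_mul (hJI : IsReduction J I) (hL : IsSaturation J I K L) :
    ∀ᶠ n in Filter.atTop, L n = K * I ^ n ∧ L (n + 1) = J * L n := by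
  obtain ⟨n₀, h₀⟩ := hL.eventually_eq
  obtain ⟨n₁, h₁⟩ := hJI.exists_mul_pow_succ_eq K
  filter_upwards [Filter.eventually_ge_atTop n₀, Filter.eventually_ge_atTop n₁] with n hn₀ hn₁
  exact ⟨h₀ n hn₀, by rw [h₀ n hn₀, h₀ (n + 1) (by lia), h₁ n hn₁]⟩

/-- The length of `L (n + 1) / J L n`. -/
noncomputable def jump (J : Ideal R) (L : ℕ → Ideal R) (n : ℕ) : ℤ :=
  ringQuotLength (J * L n) - ringQuotLength (L (n + 1))

theorem eventually_jump_eq_zero (hJI : IsReduction J I) (hL : IsSaturation J I K L) :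
    ∀ᶠ n in Filter.atTop, jump J L n = 0 := by
  filter_upwards [eventually_eq_mul hJI hL] with n hn
  rw [jump, hn.2, sub_self]

variable [IsLocalRing R]

theorem IsSaturation.containsMaximalPow (hL : IsSaturation J I K L) (hI : ContainsMaximalPow I)
    (hK : ContainsMaximalPow K) (n : ℕ) : ContainsMaximalPow (L n) :=
  (hK.mul (hI.pow n)).mono (hL.le n)

variable [IsNoetherianRing R]

/-- The degree-zero case of the second-difference formula, with R in the role of L_{-1}: J ≤ K ≤ L 0
makes the colon the unit ideal. -/
theorem jump_zero (hL : IsSaturation J I K L) (hI : ContainsMaximalPow I)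
    (hK : ContainsMaximalPow K) (hJm : ContainsMaximalPow J) {x y : R} (hxy : IsRegularPair x y)
    (hJ : J = Ideal.span {x, y}) (hJK : J ≤ K) :
    jump J L 0 = ringQuotLength J + 2 * ringQuotLength (L 0) - ringQuotLength (L 1) := by
  have h1 := ringQuotLength_span_pair_mul hxy hJ hJm (hL.containsMaximalPow hI hK 0)
  have h2 : (L 0).colon (J : Set R) = ⊤ := by
    rw [Submodule.colon_eq_top_iff_subset]
    exact hJK.trans (by simpa using hL.le 0)
  rw [h2, ringQuotLength_top] at h1
  rw [jump]
  lia

theorem jump_succ (hL : IsSaturation J I K L) (hI : ContainsMaximalPow I)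
    (hK : ContainsMaximalPow K) (hJm : ContainsMaximalPow J) {x y : R} (hxy : IsRegularPair x y)
    (hJ : J = Ideal.span {x, y}) (n : ℕ) :
    jump J L (n + 1) = ringQuotLength J + 2 * ringQuotLength (L (n + 1)) -
      ringQuotLength (L n) - ringQuotLength (L (n + 2)) := by
  have h1 := ringQuotLength_span_pair_mul hxy hJ hJm (hL.containsMaximalPow hI hK (n + 1))
  rw [hL.colon_eq] at h1
  rw [jump, add_assoc]
  lia

theorem sum_jump (hL : IsSaturation J I K L) (hI : ContainsMaximalPow I)
    (hK : ContainsMaximalPow K) (hJm : ContainsMaximalPow J) {x y : R} (hxy : IsRegularPair x y)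
    (hJ : J = Ideal.span {x, y}) (hJK : J ≤ K) (N : ℕ) :
    ∑ n ∈ Finset.range (N + 1), jump J L n = (N + 1) * ringQuotLength J + ringQuotLength (L 0) +
      ringQuotLength (L N) - ringQuotLength (L (N + 1)) := by
  induction N with
  | zero =>
    rw [zero_add, Finset.sum_range_one, jump_zero hL hI hK hJm hxy hJ hJK]
    push_cast
    ring
  | succ N ih =>
    rw [Finset.sum_range_succ, ih, jump_succ hL hI hK hJm hxy hJ]
    push_cast
    ring

/-- Vanishing jumps make the second difference of λ(R/L_n) eventually the constant λ(R/J). -/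
theorem existsUnique_isHilbertCoeffs (hJI : IsReduction J I) (hL : IsSaturation J I K L)
    (hI : ContainsMaximalPow I) (hK : ContainsMaximalPow K) (hJm : ContainsMaximalPow J) {x y : R}
    (hxy : IsRegularPair x y) (hJ : J = Ideal.span {x, y}) :
    ∃! g : Fin 3 → ℤ, IsHilbertCoeffs 2 K I g := by
  obtain ⟨N, hN⟩ := Filter.eventually_atTop.1
    ((eventually_eq_mul hJI hL).and (eventually_jump_eq_zero hJI hL))
  obtain ⟨g₁, g₂, hg⟩ := exists_eq_of_second_difference (h := fun n => ringQuotLength (L n))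
    (e := ringQuotLength J) (N := N) fun n hn => by
      have h1 := jump_succ hL hI hK hJm hxy hJ n
      rw [(hN (n + 1) (by lia)).2] at h1
      linear_combination h1
  refine ⟨![ringQuotLength J, g₁, g₂], isHilbertCoeffs_two_iff.2 ?_, fun f hf => ?_⟩
  · filter_upwards [Filter.eventually_ge_atTop N] with n hn
    rw [← (hN n hn).1.1]
    exact hg n hn
  · replace hf := isHilbertCoeffs_two_iff.1 hf
    refine eq_of_eventually_eq_quadratic ?_
    filter_upwards [hf, Filter.eventually_ge_atTop N] with n hn hnN
    rw [← hn, ← (hN n hnN).1.1]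
    exact hg n hnN

theorem eventually_sum_jump_eq (hJI : IsReduction J I) (hL : IsSaturation J I K L)
    (hI : ContainsMaximalPow I) (hK : ContainsMaximalPow K) (hJm : ContainsMaximalPow J) {x y : R}
    (hxy : IsRegularPair x y) (hJ : J = Ideal.span {x, y}) (hJK : J ≤ K) {g : Fin 3 → ℤ}
    (hg : IsHilbertCoeffs 2 K I g) :
    ∀ᶠ N in Filter.atTop, ∑ n ∈ Finset.range (N + 1), jump J L n = ringQuotLength (L 0) + g 1 := by
  obtain ⟨N, hN⟩ := Filter.eventually_atTop.1 ((isHilbertCoeffs_two_iff.1 hg).and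
    ((eventually_eq_mul hJI hL).and (eventually_jump_eq_zero hJI hL)))
  filter_upwards [Filter.eventually_ge_atTop N] with n hn
  have hP : ∀ m ≥ N, (ringQuotLength (L m) : ℤ) =
      g 0 * ((m + 1).choose 2 : ℕ) - g 1 * m + g 2 := fun m hm => by
    rw [(hN m hm).2.1.1, (hN m hm).1]
  have h0 := hP n hn
  have h1 := hP (n + 1) (by lia)
  have h2 := hP (n + 2) (by lia)
  have c1 := choose_add_two_two n
  have c2 := choose_add_two_two (n + 1)
  have hz := (hN (n + 1) (by lia)).2.2
  rw [jump_succ hL hI hK hJm hxy hJ n, h0, h1, h2, c2, c1] at hz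
  rw [sum_jump hL hI hK hJm hxy hJ hJK, h0, h1, c1]
  push_cast at hz ⊢
  -- The vanishing jump `hz` says g 0 = λ(R/J), which cancels the terms linear in n.
  linear_combination (n + 1) * hz

end Hilbert

/-! ### The graded determinant trick. -/

section Determinant

variable {R : Type*} [CommRing R]

theorem prod_ideal_le_of_forall_prod_mem {ι : Type*} {I : Ideal R} (s : Finset ι) :
    ∀ T : Ideal R, (∀ a : ι → R, (∀ i, a i ∈ I) → ∏ i ∈ s, a i ∈ T) → I ^ s.card ≤ T := by
  classical
  induction s using Finset.induction_on with
  | empty =>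
    intro T h
    have := h 0 fun _ => I.zero_mem
    rw [Finset.prod_empty] at this
    rw [(Ideal.eq_top_iff_one T).2 this]
    exact le_top
  | insert i s his ih =>
    intro T h
    rw [Finset.card_insert_of_notMem his, pow_succ', Ideal.mul_le]
    intro b hb r hr
    have h1 := ih (T.colon {b}) (fun a ha => by
      rw [Submodule.mem_colon_singleton, smul_eq_mul, mul_comm]
      have := h (Function.update a i b) (fun j => by
        rcases eq_or_ne j i with rfl | hj
        · simpa using hb
        · simpa [hj] using ha j)
      rwa [Finset.prod_insert his, Function.update_self, Finset.prod_congr rfl fun j hj =>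
        Function.update_of_ne (by rintro rfl; exact his hj) b a] at this) hr
    rwa [Submodule.mem_colon_singleton, smul_eq_mul, mul_comm] at h1

/-- Every term of the expanded difference contains some c i, giving a factor J in place of one
factor I; multiplying by b restores the lost power of I. -/
theorem mul_prod_sub_sub_prod_mem {I J : Ideal R} (hJI : J ≤ I) {ι : Type*} {a c : ι → R}
    (ha : ∀ i, a i ∈ I) (hc : ∀ i, c i ∈ J) {b : R} (hb : b ∈ I) (s : Finset ι) :
    b * (∏ i ∈ s, (a i - c i) - ∏ i ∈ s, a i) ∈ J * I ^ s.card := by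
  classical
  induction s using Finset.induction_on with
  | empty => simp
  | insert i s his ih =>
    rw [Finset.prod_insert his, Finset.prod_insert his, Finset.card_insert_of_notMem his]
    have h1 : a i * (b * (∏ i ∈ s, (a i - c i) - ∏ i ∈ s, a i)) ∈ J * I ^ (s.card + 1) := by
      rw [pow_succ', mul_left_comm J]
      exact Ideal.mul_mem_mul (ha i) ih
    have h2 : ∏ i ∈ s, (a i - c i) ∈ I ^ s.card := by
      have := Ideal.prod_mem_prod (s := s) (I := fun _ => I) (x := fun i => a i - c i)
        fun i _ => I.sub_mem (ha i) (hJI (hc i))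
      rwa [Finset.prod_const] at this
    have h3 : c i * (b * ∏ i ∈ s, (a i - c i)) ∈ J * I ^ (s.card + 1) := by
      rw [pow_succ']
      exact Ideal.mul_mem_mul (hc i) (Ideal.mul_mem_mul hb h2)
    have := Ideal.sub_mem _ h1 h3
    convert this using 1
    ring

theorem pow_mul_pow_le {I J : Ideal R} (hJI : J ≤ I) {q k m : ℕ} (hk : k ≤ q) (hm : k + 1 ≤ m) :
    I ^ (q - k) * J ^ m ≤ J * I ^ q := by
  calc I ^ (q - k) * J ^ m ≤ I ^ (q - k) * J ^ (k + 1) :=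
        Ideal.mul_mono_right (Ideal.pow_le_pow_right hm)
    _ = J * (I ^ (q - k) * J ^ k) := by rw [pow_succ]; ring
    _ ≤ J * (I ^ (q - k) * I ^ k) :=
        Ideal.mul_mono_right (Ideal.mul_mono_right (Ideal.pow_right_mono hJI k))
    _ = J * I ^ q := by rw [← pow_add, Nat.sub_add_cancel hk]

variable {ι : Type*} [Fintype ι] [DecidableEq ι]

/-- A product of the entries of a matrix along a permutation supported in `S`, where the entries
with row in `S` are graded by powers of `J`. -/
theorem prod_perm_mem {I J : Ideal R} {d e : ι → ℕ} {M : Matrix ι ι R} {σ : Equiv.Perm ι}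
    {S : Finset ι} (hS : σ.support ⊆ S)
    (hJ : ∀ i ∈ S, M i (σ i) ∈ J ^ (e i - d (σ i))) (hI : ∀ i ∉ S, M i i ∈ I) :
    ∏ i, M i (σ i) ∈ I ^ (Fintype.card ι - S.card) * J ^ (∑ i ∈ S, e i - ∑ i ∈ S, d i) := by
  have hS' : ∀ i, i ∈ S ↔ σ i ∈ S := by
    intro i
    by_cases h : σ i = i
    · rw [h]
    · exact iff_of_true (hS (Equiv.Perm.mem_support.2 h))
        (hS (Equiv.Perm.apply_mem_support.2 (Equiv.Perm.mem_support.2 h)))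
  rw [← Finset.prod_mul_prod_compl S, mul_comm]
  refine Ideal.mul_mem_mul ?_ ?_
  swap
  · have h := Ideal.prod_mem_prod (s := Sᶜ) (I := fun _ => I) (x := fun i => M i (σ i))
      fun i hi => by
        rw [Finset.mem_compl] at hi
        have h : σ i = i := Equiv.Perm.notMem_support.1 fun h => hi (hS h)
        simpa only [h] using hI i hi
    rwa [Finset.prod_const, Finset.card_compl] at h
  · have h := Ideal.prod_mem_prod (s := S) (I := fun i => J ^ (e i - d (σ i)))
      (x := fun i => M i (σ i)) hJ
    rw [Finset.prod_pow_eq_pow_sum] at h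
    refine Ideal.pow_le_pow_right ?_ h
    -- Since σ permutes S the degrees cancel. Truncated subtraction can only raise the exponent of
    -- J, so it does no harm.
    have h1 : ∑ i ∈ S, d (σ i) = ∑ i ∈ S, d i :=
      Finset.sum_equiv σ hS' fun _ _ => rfl
    rw [← h1, tsub_le_iff_right, ← Finset.sum_add_distrib]
    exact Finset.sum_le_sum fun i _ => le_tsub_add

theorem det_eq_sum_rows (M : Matrix ι ι R) :
    M.det = ∑ σ : Equiv.Perm ι, Equiv.Perm.sign σ • ∏ i, M i (σ i) := by
  rw [← Matrix.det_transpose, Matrix.det_apply]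
  rfl

variable {I J : Ideal R} {d : ι → ℕ} {a : ι → R} {C : Matrix ι ι R}

theorem prod_perm_diagonal_sub_mem (hJI : J ≤ I) (ha : ∀ i, a i ∈ I)
    (hC : ∀ i j, C i j ∈ J ^ (d i + 1 - d j)) (σ : Equiv.Perm ι) :
    ∏ i, (Matrix.diagonal a - C) i (σ i) ∈
      I ^ (Fintype.card ι - σ.support.card) * J ^ σ.support.card := by
  have h := prod_perm_mem (M := Matrix.diagonal a - C) (d := d) (e := fun i => d i + 1)
    (subset_refl σ.support) (I := I) (J := J) (fun i hi => ?_) fun i _ => ?_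
  · rwa [Finset.sum_add_distrib, Nat.add_sub_cancel_left, Finset.sum_const, smul_eq_mul,
      mul_one] at h
  · rw [Matrix.sub_apply, Matrix.diagonal_apply_ne _ (Equiv.Perm.mem_support.1 hi).symm, zero_sub]
    exact neg_mem (hC _ _)
  · have h := hC i i
    rw [Nat.add_sub_cancel_left, pow_one] at h
    rw [Matrix.sub_apply, Matrix.diagonal_apply_eq]
    exact I.sub_mem (ha i) (hJI h)

theorem det_diagonal_sub_mem (hJI : J ≤ I) (ha : ∀ i, a i ∈ I)
    (hC : ∀ i j, C i j ∈ J ^ (d i + 1 - d j)) :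
    (Matrix.diagonal a - C).det ∈ I ^ Fintype.card ι := by
  rw [det_eq_sum_rows]
  refine Ideal.sum_mem _ fun σ _ => Submodule.smul_of_tower_mem _ _ ?_
  refine (Ideal.mul_mono_right (Ideal.pow_right_mono hJI _) : _ ≤ _).trans ?_
    (prod_perm_diagonal_sub_mem hJI ha hC σ)
  rw [← pow_add, Nat.sub_add_cancel (Finset.card_le_univ _)]

theorem mul_det_diagonal_sub_sub_prod_mem (hJI : J ≤ I) (ha : ∀ i, a i ∈ I)
    (hC : ∀ i j, C i j ∈ J ^ (d i + 1 - d j)) {b : R} (hb : b ∈ I) :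
    b * ((Matrix.diagonal a - C).det - ∏ i, a i) ∈ J * I ^ Fintype.card ι := by
  have h1 := mul_prod_sub_sub_prod_mem hJI ha (fun i => by simpa using hC i i) hb Finset.univ
  have h2 : b * ∑ σ ∈ Finset.univ.erase (1 : Equiv.Perm ι),
      Equiv.Perm.sign σ • ∏ i, (Matrix.diagonal a - C) i (σ i) ∈ J * I ^ Fintype.card ι := by
    rw [Finset.mul_sum]
    refine Ideal.sum_mem _ fun σ hσ => ?_
    rw [mul_smul_comm]
    refine Submodule.smul_of_tower_mem _ _ ?_
    have h3 := Ideal.mul_mem_mul hb (prod_perm_diagonal_sub_mem hJI ha hC σ)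
    -- A nontrivial permutation contributes at least one factor of J, and b supplies the power of I
    -- traded for it.
    obtain ⟨k, hk⟩ : ∃ k, σ.support.card = k + 1 := Nat.exists_eq_succ_of_ne_zero
      (Equiv.Perm.card_support_eq_zero.not.2 (Finset.ne_of_mem_erase hσ))
    have hle : k + 1 ≤ Fintype.card ι := hk ▸ Finset.card_le_univ _
    rw [hk, ← mul_assoc, ← pow_succ', show Fintype.card ι - (k + 1) + 1 = Fintype.card ι - k by lia]
      at h3
    exact pow_mul_pow_le hJI (by lia) le_rfl h3
  have h3 := Ideal.add_mem _ h1 h2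
  rw [Finset.card_univ] at h3
  rw [det_eq_sum_rows, ← Finset.add_sum_erase _ _ (Finset.mem_univ (1 : Equiv.Perm ι))]
  convert h3 using 1
  simp only [Equiv.Perm.sign_one, one_smul, Equiv.Perm.one_apply, Matrix.sub_apply,
    Matrix.diagonal_apply_eq]
  ring

theorem det_updateRow_mul_mem (hJI : J ≤ I) (ha : ∀ i, a i ∈ I)
    (hC : ∀ i j, C i j ∈ J ^ (d i + 1 - d j)) {c : ι → R} (hc : ∀ j, c j ∈ J ^ (2 - d j))
    (i : ι) {N : Ideal R} {n : R} (hn : n ∈ J ^ d i * N) :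
    ((Matrix.diagonal a - C).updateRow i c).det * n ∈ J * I ^ Fintype.card ι * N := by
  rw [det_eq_sum_rows, Finset.sum_mul]
  refine Ideal.sum_mem _ fun σ _ => ?_
  rw [smul_mul_assoc]
  refine Submodule.smul_of_tower_mem _ _ ?_
  -- Row i now has degree 2 and must be counted in S even if σ fixes i. With the factor J^(d i) from
  -- n, the exponent of J is at least |S| + 1, one more than the number of factors I missing.
  have h := prod_perm_mem (M := (Matrix.diagonal a - C).updateRow i c) (d := d)
    (e := fun j => if j = i then 2 else d j + 1) (Finset.subset_insert i σ.support)
    (I := I) (J := J) (fun j hj => ?_) fun j hj => ?_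
  · set S := insert i σ.support
    have hsum : ∑ j ∈ S, (if j = i then 2 else d j + 1) + d i = ∑ j ∈ S, d j + S.card + 1 := by
      have hi : i ∈ S := Finset.mem_insert_self i _
      rw [← Finset.add_sum_erase _ _ hi, ← Finset.add_sum_erase _ d hi,
        Finset.sum_congr rfl fun j hj => if_neg (Finset.ne_of_mem_erase hj), if_pos rfl,
        Finset.sum_add_distrib, Finset.sum_const, Finset.card_erase_of_mem hi]
      have := Finset.card_pos.2 ⟨i, hi⟩
      simp only [smul_eq_mul, mul_one]
      lia
    have h1 := Ideal.mul_mem_mul h hn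
    rw [mul_assoc, ← mul_assoc (J ^ _), ← pow_add, ← mul_assoc] at h1
    exact Ideal.mul_mono_left (pow_mul_pow_le hJI (Finset.card_le_univ _) (by lia)) h1
  · rcases eq_or_ne j i with rfl | hji
    · simpa using hc (σ j)
    · have hσ := Equiv.Perm.mem_support.1 ((Finset.mem_insert.1 hj).resolve_left hji)
      rw [Matrix.updateRow_ne hji, if_neg hji, Matrix.sub_apply,
        Matrix.diagonal_apply_ne _ hσ.symm, zero_sub]
      exact neg_mem (hC _ _)
  · have hji : j ≠ i := fun h => hj (h ▸ Finset.mem_insert_self _ _)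
    have h := hC j j
    rw [Nat.add_sub_cancel_left, pow_one] at h
    rw [Matrix.updateRow_ne hji, Matrix.sub_apply, Matrix.diagonal_apply_eq]
    exact I.sub_mem (ha j) (hJI h)

/-- The determinant trick bounding the reduction number by the number of generators of a module
over the Rees algebra of `J`. -/
theorem pow_card_mul_le {I J K : Ideal R} (hJI : J ≤ I) {d : ι → ℕ} {f : ι → R}
    (hf : ∀ i, ∀ a ∈ I, ∃ C : ι → R, (∀ j, C j ∈ J ^ (d i + 1 - d j)) ∧
      a * f i - ∑ j, C j * f j ∈ J ^ d i * (K * I))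
    (hz : ∀ z ∈ K * I ^ 2, ∃ c : ι → R, (∀ j, c j ∈ J ^ (2 - d j)) ∧
      z - ∑ j, c j * f j ∈ J * (K * I)) :
    I ^ Fintype.card ι * (K * I ^ 2) ≤ J * (K * I ^ (Fintype.card ι + 1)) := by
  have hgoal : J * I ^ Fintype.card ι * (K * I) = J * (K * I ^ (Fintype.card ι + 1)) := by ring
  rw [Ideal.mul_le]
  suffices H : I ^ (Finset.univ : Finset ι).card ≤
      (J * (K * I ^ (Fintype.card ι + 1))).colon ((K * I ^ 2 : Ideal R) : Set R) from
    fun r hr z hz => Submodule.mem_colon.1 (H hr) z hz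
  refine prod_ideal_le_of_forall_prod_mem _ _ fun a ha => ?_
  rw [Submodule.mem_colon]
  intro z (hzm : z ∈ K * I ^ 2)
  choose C hC hn using fun i => hf i (a i) (ha i)
  obtain ⟨c, hc, hcz⟩ := hz z hzm
  set M := Matrix.diagonal a - Matrix.of C with hM
  set n : ι → R := fun i => a i * f i - ∑ j, C i j * f j with hn_def
  have hMf : M.mulVec f = n := by
    ext i
    rw [hM, Matrix.sub_mulVec, Pi.sub_apply, Matrix.mulVec_diagonal]
    rfl
  -- Cramer's rule for M f = n, paired with the row c.
  have hcr : M.det * ∑ j, c j * f j = ∑ i, (M.updateRow i c).det * n i := by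
    have h1 : M.det • f = M.adjugate.mulVec n := by
      rw [← hMf, Matrix.mulVec_mulVec, Matrix.adjugate_mul, Matrix.smul_mulVec, Matrix.one_mulVec]
    have h2 : ∀ i, (M.updateRow i c).det = Matrix.vecMul c M.adjugate i := by
      intro i
      rw [← Matrix.cramer_transpose_apply, Matrix.cramer_eq_adjugate_mulVec,
        ← Matrix.adjugate_transpose, Matrix.mulVec_transpose]
    calc M.det * ∑ j, c j * f j = c ⬝ᵥ (M.det • f) := by
          rw [dotProduct_smul]
          rfl
      _ = Matrix.vecMul c M.adjugate ⬝ᵥ n := by rw [h1, Matrix.dotProduct_mulVec]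
      _ = _ := Finset.sum_congr rfl fun i _ => by rw [h2]
  have h1 : M.det * ∑ j, c j * f j ∈ J * (K * I ^ (Fintype.card ι + 1)) := by
    rw [hcr, ← hgoal]
    exact Ideal.sum_mem _ fun i _ => det_updateRow_mul_mem hJI ha hC hc i (hn i)
  have h2 : M.det * (z - ∑ j, c j * f j) ∈ J * (K * I ^ (Fintype.card ι + 1)) := by
    have := Ideal.mul_mem_mul (det_diagonal_sub_mem (C := Matrix.of C) hJI ha hC) hcz
    rw [← hgoal]
    convert this using 1
    ring
  -- One factor I of z, which lies in I · KI, plays the part of b.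
  have h3 : (M.det - ∏ i, a i) * z ∈ J * (K * I ^ (Fintype.card ι + 1)) := by
    have hle : I * (K * I) ≤
        (J * (K * I ^ (Fintype.card ι + 1))).colon ({M.det - ∏ i, a i} : Set R) := by
      rw [Ideal.mul_le]
      intro b hb w hw
      rw [Submodule.mem_colon_singleton, ← hgoal]
      have := Ideal.mul_mem_mul (mul_det_diagonal_sub_sub_prod_mem (C := Matrix.of C) hJI ha hC hb) hw
      convert this using 1
      rw [smul_eq_mul]
      ring
    have hzm' : z ∈ I * (K * I) := by
      convert hzm using 1
      ring
    have := Submodule.mem_colon_singleton.1 (hle hzm')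
    rwa [smul_eq_mul, mul_comm z] at this
  have h4 := Ideal.sub_mem _ (Ideal.add_mem _ h1 h2) h3
  convert h4 using 1
  rw [smul_eq_mul]
  ring

end Determinant

/-! ### Homogeneous generation over the Rees algebra of J. -/

section Generation

variable {R : Type*} [CommRing R]

/-- Induction on the degree: multiplying by J raises each coefficient's power by one. For d i > n
truncation leaves the coefficient unrestricted, a weakening that the determinant trick tolerates. -/
theorem exists_coeff_of_generators {J : Ideal R} {L N : ℕ → Ideal R} {ι : Type*} [Fintype ι]
    {d : ι → ℕ} {f : ι → R} (hN : ∀ n, J * N n ≤ N (n + 1))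
    (h0 : L 0 ≤ N 0 ⊔ Ideal.span {x | ∃ i, d i = 0 ∧ f i = x})
    (hs : ∀ n, L (n + 1) ≤ J * L n ⊔ N (n + 1) ⊔ Ideal.span {x | ∃ i, d i = n + 1 ∧ f i = x})
    (n : ℕ) : ∀ w ∈ L n, ∃ c : ι → R, (∀ i, c i ∈ J ^ (n - d i)) ∧ w - ∑ i, c i * f i ∈ N n := by
  classical
  let U : ℕ → Ideal R := fun n => N n ⊔
    Submodule.map (Fintype.linearCombination R f) (Submodule.pi Set.univ fun i => J ^ (n - d i))
  have hmem : ∀ n w, w ∈ U n ↔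
      ∃ c : ι → R, (∀ i, c i ∈ J ^ (n - d i)) ∧ w - ∑ i, c i * f i ∈ N n := by
    intro n w
    constructor
    · intro hw
      obtain ⟨p, hp, q, ⟨c, hc, rfl⟩, rfl⟩ := Submodule.mem_sup.1 hw
      refine ⟨c, fun i => hc i (Set.mem_univ i), ?_⟩
      simpa [Fintype.linearCombination_apply] using hp
    · rintro ⟨c, hc, hp⟩
      refine Submodule.mem_sup.2 ⟨_, hp, ∑ i, c i * f i, ⟨c, fun i _ => hc i, ?_⟩, by ring⟩
      simp [Fintype.linearCombination_apply]
  have hgen : ∀ n, Ideal.span {x | ∃ i, d i = n ∧ f i = x} ≤ U n := by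
    intro n
    rw [Ideal.span_le]
    rintro _ ⟨i, hi, rfl⟩
    refine (hmem _ _).2 ⟨Pi.single i 1, fun j => ?_, ?_⟩
    · rcases eq_or_ne j i with rfl | hj
      · simp [hi, Ideal.one_eq_top]
      · simp [hj]
    · simp [Pi.single_apply]
  have hle : ∀ n, L n ≤ U n := by
    intro n
    induction n with
    | zero => exact h0.trans (sup_le le_sup_left (hgen 0))
    | succ n ih =>
      refine (hs n).trans (sup_le (sup_le ?_ le_sup_left) (hgen _))
      refine (Ideal.mul_mono_right ih).trans ?_
      rw [Ideal.mul_le]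
      intro a ha w hw
      obtain ⟨c, hc, hp⟩ := (hmem _ _).1 hw
      refine (hmem _ _).2 ⟨fun i => a * c i, fun i => ?_, ?_⟩
      · have := Ideal.mul_mem_mul ha (hc i)
        rw [← pow_succ'] at this
        exact Ideal.pow_le_pow_right (by lia) this
      · have := hN n (Ideal.mul_mem_mul ha hp)
        convert this using 1
        rw [mul_sub, Finset.mul_sum]
        simp only [mul_assoc]
  exact fun w hw => (hmem n w).1 (hle n hw)

end Generation

/-! ### Counting generators and the final bound. -/

section Bound

variable {R : Type*} [CommRing R] {J I K : Ideal R} {L : ℕ → Ideal R}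

/-- The terms of the `J`-filtration generated by `K` in degree zero and `K I` in degree one. -/
def lowDegreePart (J I K : Ideal R) : ℕ → Ideal R
  | 0 => K
  | n + 1 => J ^ n * (K * I)

theorem mul_lowDegreePart_le (hJI : J ≤ I) (n : ℕ) :
    J * lowDegreePart J I K n ≤ lowDegreePart J I K (n + 1) := by
  rcases n with _ | n
  · simp only [lowDegreePart, pow_zero, one_mul]
    rw [mul_comm]
    exact Ideal.mul_mono_right hJI
  · simp only [lowDegreePart]
    rw [← mul_assoc, ← pow_succ']

theorem IsSaturation.lowDegreePart_le (hL : IsSaturation J I K L) (hJI : J ≤ I) (n : ℕ) :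
    lowDegreePart J I K n ≤ L n := by
  refine le_trans ?_ (hL.le n)
  rcases n with _ | n
  · simp [lowDegreePart]
  · calc J ^ n * (K * I) ≤ I ^ n * (K * I) := Ideal.mul_mono_left (Ideal.pow_right_mono hJI n)
      _ = K * I ^ (n + 1) := by ring

theorem IsSaturation.mul_le_succ (hL : IsSaturation J I K L) (hJI : J ≤ I) (n : ℕ) :
    J * L n ≤ L (n + 1) :=
  (Ideal.mul_mono_left hJI).trans (hL.mul_le n)

/-- No generators are needed above degree m + 1. The final 1 comes from the determinant trick
starting at K I ^ 2, where the discarded part is J K I. -/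
theorem kReductionNumber_le_of_generators (hJI : IsReduction J I) (hL : IsSaturation J I K L)
    {m : ℕ} (hm : ∀ n > m, L (n + 1) = J * L n) (s : ℕ → Finset R)
    (h0 : K ⊔ Ideal.span (s 0 : Set R) = L 0)
    (hs : ∀ n, J * L n ⊔ lowDegreePart J I K (n + 1) ⊔ Ideal.span (s (n + 1) : Set R) =
      L (n + 1)) :
    kReductionNumber K J I ≤ ∑ n ∈ Finset.range (m + 2), (s n).card + 1 := by
  classical
  let ι := Σ n : Fin (m + 2), s n
  let d : ι → ℕ := fun i => i.1
  let f : ι → R := fun i => i.2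
  have hcard : Fintype.card ι = ∑ n ∈ Finset.range (m + 2), (s n).card := by
    rw [Fintype.card_sigma, Finset.sum_range]
    simp
  have hspan : ∀ n < m + 2, Ideal.span (s n : Set R) ≤
      Ideal.span {x | ∃ i : ι, d i = n ∧ f i = x} := fun n hn =>
    Ideal.span_mono fun x hx => ⟨⟨⟨n, hn⟩, ⟨x, hx⟩⟩, rfl, rfl⟩
  have hfL : ∀ i, f i ∈ L (d i) := by
    rintro ⟨⟨n, hn⟩, ⟨x, hx⟩⟩
    rcases n with _ | n
    · exact h0 ▸ Ideal.mem_sup_right (Ideal.subset_span hx)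
    · exact hs n ▸ Ideal.mem_sup_right (Ideal.subset_span hx)
  have key := exists_coeff_of_generators (L := L) (N := lowDegreePart J I K) (d := d) (f := f)
    (mul_lowDegreePart_le hJI.1) (h0.ge.trans (sup_le_sup_left (hspan 0 (by lia)) _)) fun n => by
      by_cases hn : n > m
      · rw [hm n hn]
        exact le_sup_left.trans le_sup_left
      · exact (hs n).ge.trans (sup_le_sup_left (hspan (n + 1) (by lia)) _)
  have h := pow_card_mul_le (K := K) hJI.1 (d := d) (f := f)
    (fun i a ha => key (d i + 1) _ (hL.mul_le _ (Ideal.mul_mem_mul ha (hfL i))))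
    (fun z hz => by simpa [lowDegreePart] using key 2 z (hL.le 2 hz))
  rw [← hcard]
  refine Nat.sInf_le (le_antisymm ?_ ?_)
  · convert h using 1 <;> ring
  · rw [mul_assoc, pow_succ' I (Fintype.card ι + 1)]
    exact Ideal.mul_mono_right (Ideal.mul_mono_left hJI.1)

theorem kReductionNumber_le [IsLocalRing R] [IsNoetherianRing R] (hJI : IsReduction J I)
    (hL : IsSaturation J I K L) (hI : ContainsMaximalPow I) (hK : ContainsMaximalPow K)
    (hJm : ContainsMaximalPow J) {x y : R}
    (hxy : IsRegularPair x y) (hJ : J = Ideal.span {x, y}) (hJK : J ≤ K)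
    (hKJ : K * I ⊓ J = K * J) {g : Fin 3 → ℤ} (hg : IsHilbertCoeffs 2 K I g) :
    (kReductionNumber K J I : ℤ) ≤
      g 1 - (quotLength (K * I) (K * J) : ℤ) + 1 + (ringQuotLength K : ℤ) := by
  have hLm := hL.containsMaximalPow hI hK
  have hex : ∀ n, ∃ s : Finset R, J * L n ⊔ lowDegreePart J I K (n + 1) ⊔
      Ideal.span (s : Set R) = L (n + 1) ∧
      s.card + ringQuotLength (L (n + 1)) ≤
        ringQuotLength (J * L n ⊔ lowDegreePart J I K (n + 1)) := fun n =>
    exists_finset_span_sup_eq ((hJm.mul (hLm n)).mono le_sup_left) _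
      (sup_le (hL.mul_le_succ hJI.1 n) (hL.lowDegreePart_le hJI.1 _))
  have hKL : K ≤ L 0 := by simpa using hL.le 0
  obtain ⟨s₀, hs₀, hc₀⟩ := exists_finset_span_sup_eq hK (L 0) hKL
  choose s hs hc using hex
  let t : ℕ → Finset R
    | 0 => s₀
    | n + 1 => s n
  obtain ⟨m, hm⟩ := Filter.eventually_atTop.1 ((eventually_eq_mul hJI hL).and
    (eventually_sum_jump_eq hJI hL hI hK hJm hxy hJ hJK hg))
  have hbound := kReductionNumber_le_of_generators hJI hL (m := m)
    (fun n hn => (hm n hn.le).1.2) t hs₀ hs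
  have ht : ∑ n ∈ Finset.range (m + 2), (t n).card =
      ∑ n ∈ Finset.range m, (s (n + 1)).card + (s 0).card + s₀.card := by
    rw [Finset.sum_range_succ', Finset.sum_range_succ']
  rw [ht] at hbound
  have hsum := (hm m le_rfl).2
  rw [Finset.sum_range_succ'] at hsum
  have hjump : (∑ n ∈ Finset.range m, (s (n + 1)).card : ℤ) ≤
      ∑ n ∈ Finset.range m, jump J L (n + 1) := by
    refine Finset.sum_le_sum fun n _ => ?_
    have h1 := hc (n + 1)
    -- From degree 2 on the discarded submodule is already in J L, so the generators there number at
    -- most the jump; only degrees 0 and 1 profit from it.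
    have h2 : lowDegreePart J I K (n + 1 + 1) ≤ J * L (n + 1) := by
      have h3 : lowDegreePart J I K (n + 1 + 1) = J * lowDegreePart J I K (n + 1) := by
        simp only [lowDegreePart]
        rw [pow_succ', mul_assoc]
      rw [h3]
      exact Ideal.mul_mono_right (hL.lowDegreePart_le hJI.1 _)
    rw [sup_eq_left.2 h2] at h1
    rw [jump]
    lia
  have hs1 := hc 0
  have hlow : lowDegreePart J I K (0 + 1) = K * I := by simp [lowDegreePart]
  rw [hlow] at hs1
  -- The assumption K I ∩ J = K J enters here: it gives λ((J L_0 + K I)/J L_0) = λ(KI/KJ), the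
  -- saving in degree one.
  have hinf : J * L 0 ⊓ K * I = K * J := by
    refine le_antisymm ?_ (le_inf ?_ (Ideal.mul_mono_right hJI.1))
    · rw [inf_comm, ← hKJ]
      exact inf_le_inf_left _ Ideal.mul_le_left
    · rw [mul_comm]
      exact Ideal.mul_mono_right hKL
  have hmod := ringQuotLength_sup_add_inf (hJm.mul (hLm 0)) (hK.mul hI)
  rw [hinf] at hmod
  have hkos := ringQuotLength_span_pair_mul hxy hJ hJm hK
  rw [(Submodule.colon_eq_top_iff_subset _).2 hJK, ringQuotLength_top, mul_comm J K] at hkos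
  have hj0 := jump_zero hL hI hK hJm hxy hJ hJK
  have hj0' : jump J L 0 = ringQuotLength (J * L 0) - ringQuotLength (L 1) := rfl
  have hq := quotLength_add_ringQuotLength (hK.mul hJm) (Ideal.mul_mono_right hJI.1 : K * J ≤ K * I)
  simp only [zero_add] at hs1 hbound hc₀ hsum
  zify at hbound
  lia

end Bound

end FiberCone

theorem corollary3p5 {R : Type*} [CommRing R] [IsLocalRing R] [Infinite (IsLocalRing.ResidueField R)]
    (hCM : FiberCone.IsCohenMacaulayLocal R) (hdim : ringKrullDim R = 2)
    (I J K : Ideal R) (hI : FiberCone.IsMaximalPrimary I) (hIK : I ≤ K)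
    (hJ : FiberCone.IsMinimalReduction J I) (hKJ : (K * I) ⊓ J = K * J) :
    (∃! g : Fin 3 → ℤ, FiberCone.IsHilbertCoeffs 2 K I g) ∧
    ∀ g : Fin 3 → ℤ, FiberCone.IsHilbertCoeffs 2 K I g →
      (FiberCone.kReductionNumber K J I : ℤ) ≤
        g 1 - (FiberCone.quotLength (K * I) (K * J) : ℤ) + 1 + (FiberCone.ringQuotLength K : ℤ) := by
  have : IsNoetherianRing R := hCM.1
  have hIm : FiberCone.ContainsMaximalPow I := by
    obtain ⟨n, hn⟩ := I.exists_radical_pow_le_of_fg (IsNoetherian.noetherian _)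
    exact ⟨n, hI.2 ▸ hn⟩
  have hI1 : I ≤ IsLocalRing.maximalIdeal R := IsLocalRing.le_maximalIdeal hI.1.1
  have hJI := hJ.1
  have hJm : FiberCone.ContainsMaximalPow J := by
    obtain ⟨n, hn⟩ := hJI.2
    exact (hIm.pow (n + 1)).mono (hn ▸ Ideal.mul_le_left)
  obtain ⟨a, ha, b, hb, hab, habm⟩ := hCM.exists_isRegularPair hdim
  obtain ⟨x₀, y₀, hJ₀⟩ := hJ.exists_span_pair ha hb habm hJm (hJI.1.trans hI1)
  obtain ⟨x, y, hxy, hspan⟩ := hab.exists_of_span_pair ha hb (x := x₀) (y := y₀) (hJ₀ ▸ hJm)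
  have hJxy := hJ₀.trans hspan
  obtain ⟨L, hL⟩ := hJI.exists_isSaturation (x := x)
    (hJxy ▸ Ideal.subset_span (by simp)) hxy.1 K
  have hKm := hIm.mono hIK
  exact ⟨FiberCone.existsUnique_isHilbertCoeffs hJI hL hIm hKm hJm hxy hJxy, fun g hg =>
    FiberCone.kReductionNumber_le hJI hL hIm hKm hJm hxy hJxy (hJI.1.trans hIK) hKJ hg⟩
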